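/- Let $X$ be a path connected, compactly generated space with a non-degenerate base point $*$, having the homotopy type of a CW complex. Products are taken in compactly generated spaces. $[Z,Y]$ denotes pointed homotopy classes of pointed maps, and $X^{(2)}=X\wedge X$. Assume that $X$ has weak LS-category less than $2$, i.e. the reduced diagonal $\bar\Delta\colon X\to X\wedge X$ is null homotopic. Let $J(X)$ be the James construction (the free topological monoid on $X$ with $*$ as unit, with the quotient topology from $\bigsqcup_k X^k$), let $E\colon X\to J(X)$ be the canonical map, let $J_n(X)$ be the coequalizer of the inclusions $i_j\colon X^{n-1}\to X^n$ ($1\le j\le n$) that insert $*$ in the $j$-th place, and let $q_n\colon X^n\to J_n(X)$ be the quotient map. The sets $[X^n,J(X)]$ and $[J_n(X),J(X)]$ are given the multiplication induced by that of $J(X)$. Let $x_i\in[X^n,J(X)]$ be the class of $X^n\xrightarrow{p_i}X\xrightarrow{E}J(X)$, where $p_i$ is the $i$-th coordinate projection. Let $K_n(X)\subseteq[X^n,J(X)]$ be the subgroup generated by $x_1,\dots,x_n$, and let $\mathcal H_n(X)\subseteq[J_n(X),J(X)]$ be the subgroup of classes $\beta$ with $q_n^*\beta\in K_n(X)$. Write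 $[x,y]=x^{-1}y^{-1}xy$ and $[[a_1,\dots,a_l]=[\cdots[a_1,a_2],\cdots,a_l]$ for $l\ge 1$. Let $K_n$ be the group with generators $x_1,\dots,x_n$ and relations, for all $l\ge1$, all indices $i_1,\dots,i_l$ and all integers $m_1,\dots,m_l$, $$[[x_{i_1},\dots,x_{i_l}]=1\ \text{ if } i_s=i_t \text{ for some } s<t,\qquad [[x_{i_1}^{m_1},\dots,x_{i_l}^{m_l}]=[[x_{i_1},\dots,x_{i_l}]^{m_1\cdots m_l}.$$ For $1\le j\le n$ let $d_j\colon K_n\to K_{n-1}$ be the homomorphism with $d_j(x_i)=x_i$ for $i<j$, $d_j(x_j)=1$, and $d_j(x_i)=x_{i-1}$ for $i>j$. Let $\mathcal H_n=\{a\in K_n : d_1(a)=\dots=d_n(a)\}$ be their equalizer (so $\mathcal H_0=K_0$). Then for every $n\ge 0$ the monoids $[X^n,J(X)]$ and $[J_n(X),J(X)]$ are groups, and there are homomorphisms $$e_X\colon K_n\to K_n(X)\subseteq[X^n,J(X)],\quad e_X(x_i)=x_i,\qquad\qquad e_X\colon \mathcal H_n\to\mathcal H_n(X)\subseteq[J_n(X),J(X)]$$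 such that $q_n^*(e_X(a))=e_X(a)$ in $[X^n,J(X)]$ for every $a\in\mathcal H_n$, where the left-hand $e_X$ is the one on $\mathcal H_n$ and the right-hand one is that on $K_n$. -/

import Mathlib

open TopologicalSpace Topology

universe u

/-! ### Combinatorial groups -/

section Combinatorial

/-- The commutator with the convention `[x, y] = x⁻¹ y⁻¹ x y`. -/
def rightComm {G : Type*} [Group G] (x y : G) : G := x⁻¹ * y⁻¹ * x * y

/-- The left-normed iterated commutator `[[a₀, a₁, …, a_l] = [⋯[a₀, a₁], ⋯, a_l]` of a nonempty
list of elements (of length `l + 1`). -/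
def iterComm {G : Type*} [Group G] : (l : ℕ) → (Fin (l + 1) → G) → G
  | 0, a => a 0
  | l + 1, a => rightComm (iterComm l fun s => a s.castSucc) (a (Fin.last (l + 1)))

theorem map_iterComm {G H : Type*} [Group G] [Group H] (f : G →* H) :
    ∀ (l : ℕ) (a : Fin (l + 1) → G), f (iterComm l a) = iterComm l fun s => f (a s)
  | 0, a => rfl
  | l + 1, a => by simp [iterComm, rightComm, map_iterComm f l]

theorem iterComm_eq_one {G : Type*} [Group G] :
    ∀ (l : ℕ) (a : Fin (l + 1) → G), (∃ s, a s = 1) → iterComm l a = 1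
  | 0, a, ⟨s, hs⟩ => by
      have h0 : s = 0 := Fin.ext (by omega)
      subst h0
      exact hs
  | l + 1, a, ⟨s, hs⟩ => by
      induction s using Fin.lastCases with
      | last => simp [iterComm, rightComm, hs]
      | cast s =>
        have := iterComm_eq_one l (fun s => a s.castSucc) ⟨s, hs⟩
        simp [iterComm, rightComm, this]

/-- The defining relators of the Cohen group on `n` generators:
`[[x_{i₀}, …, x_{i_l}]` whenever two of the indices agree, and
`[[x_{i₀}^{m₀}, …, x_{i_l}^{m_l}] = [[x_{i₀}, …, x_{i_l}]^{m₀ ⋯ m_l}`. -/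
def cohenRels (n : ℕ) : Set (FreeGroup (Fin n)) :=
  {r | ∃ (l : ℕ) (i : Fin (l + 1) → Fin n), (∃ s t, s < t ∧ i s = i t) ∧
      r = iterComm l fun s => FreeGroup.of (i s)} ∪
  {r | ∃ (l : ℕ) (i : Fin (l + 1) → Fin n) (m : Fin (l + 1) → ℤ),
      r = (iterComm l fun s => FreeGroup.of (i s) ^ m s) *
        ((iterComm l fun s => FreeGroup.of (i s)) ^ ∏ s, m s)⁻¹}

/-- The Cohen group `K_n`. -/
abbrev CohenK (n : ℕ) : Type := PresentedGroup (cohenRels n)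

/-- The generator `x_i` of `K_n`. -/
def CohenK.x {n : ℕ} (i : Fin n) : CohenK n := PresentedGroup.of i

theorem CohenK.rel_one {n : ℕ} (l : ℕ) (i : Fin (l + 1) → Fin n) (h : ∃ s t, s < t ∧ i s = i t) :
    (iterComm l fun s => CohenK.x (i s)) = 1 := by
  have h1 := PresentedGroup.one_of_mem (rels := cohenRels n)
    (x := iterComm l fun s => FreeGroup.of (i s)) (Or.inl ⟨l, i, h, rfl⟩)
  rw [map_iterComm] at h1
  exact h1

theorem CohenK.rel_pow {n : ℕ} (l : ℕ) (i : Fin (l + 1) → Fin n) (m : Fin (l + 1) → ℤ) :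
    (iterComm l fun s => CohenK.x (i s) ^ m s) = (iterComm l fun s => CohenK.x (i s)) ^ ∏ s, m s := by
  have h1 := PresentedGroup.one_of_mem (rels := cohenRels n)
    (x := (iterComm l fun s => FreeGroup.of (i s) ^ m s) *
        ((iterComm l fun s => FreeGroup.of (i s)) ^ ∏ s, m s)⁻¹) (Or.inr ⟨l, i, m, rfl⟩)
  rw [map_mul, map_inv, map_zpow, map_iterComm, map_iterComm, mul_inv_eq_one] at h1
  simp only [map_zpow] at h1
  exact h1

/-- The assignment on generators of the `j`-th projection: `x_j ↦ 1`, and the remaining generators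
of `K_{n+1}` are sent in order to those of `K_n`. -/
def CohenK.dGen {n : ℕ} (j : Fin (n + 1)) : Fin (n + 1) → CohenK n :=
  Fin.insertNth (α := fun _ => CohenK n) j 1 CohenK.x

theorem CohenK.dGen_cases {n : ℕ} (j : Fin (n + 1)) {ι : Type*} (i : ι → Fin (n + 1)) :
    (∃ s, dGen j (i s) = 1) ∨
      ∃ i' : ι → Fin n, (∀ s, i s = j.succAbove (i' s)) ∧ ∀ s, dGen j (i s) = x (i' s) := by
  by_cases h : ∃ s, i s = j
  · obtain ⟨s, hs⟩ := h
    exact Or.inl ⟨s, by simp [dGen, hs]⟩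
  · push Not at h
    choose i' hi' using fun s => Fin.exists_succAbove_eq (h s)
    refine Or.inr ⟨i', fun s => (hi' s).symm, fun s => ?_⟩
    rw [← hi' s, dGen, Fin.insertNth_apply_succAbove]

/-- The projection `d_j : K_{n+1} → K_n`. -/
def CohenK.d {n : ℕ} (j : Fin (n + 1)) : CohenK (n + 1) →* CohenK n :=
  PresentedGroup.toGroup (f := dGen j) (by
    rintro r (⟨l, i, ⟨s, t, hst, hi⟩, rfl⟩ | ⟨l, i, m, rfl⟩)
    · rw [map_iterComm]
      simp only [FreeGroup.lift_apply_of]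
      rcases dGen_cases j i with h | ⟨i', h1, h2⟩
      · exact iterComm_eq_one l _ h
      · simp only [h2]
        refine rel_one l i' ⟨s, t, hst, ?_⟩
        rw [h1 s, h1 t] at hi
        exact Fin.succAbove_right_injective hi
    · rw [map_mul, map_inv, map_zpow, map_iterComm, map_iterComm, mul_inv_eq_one]
      simp only [map_zpow, FreeGroup.lift_apply_of]
      rcases dGen_cases j i with h | ⟨i', h1, h2⟩
      · rw [iterComm_eq_one l _ h, one_zpow]
        obtain ⟨s, hs⟩ := h
        exact iterComm_eq_one l _ ⟨s, by rw [hs, one_zpow]⟩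
      · simp only [h2]
        exact rel_pow l i' m)

/-- The combinatorial group `H_n`: the equalizer of the projections `d_j : K_n → K_{n-1}`
(for `n = 0` there are no projections). -/
def cohenH : (n : ℕ) → Subgroup (CohenK n)
  | 0 => ⊤
  | _ + 1 => ⨅ i, ⨅ j, (CohenK.d i).eqLocus (CohenK.d j)

end Combinatorial

/-! ### Compactly generated spaces -/

section CG

/-- The `n`-fold cartesian power of `X` in compactly generated spaces: the set `X^n` with the
compactly generated refinement of the product topology. -/
def CGPow (X : Type u) (n : ℕ) : Type u := Fin n → X

variable {X : Type u} [TopologicalSpace X]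

instance CGPow.instTopologicalSpace (n : ℕ) : TopologicalSpace (CGPow X n) :=
  TopologicalSpace.compactlyGenerated.{u} (Fin n → X)

/-- The underlying tuple of a point of the power. -/
def CGPow.toPi {n : ℕ} (x : CGPow X n) : Fin n → X := x

theorem CGPow.continuous_toPi (n : ℕ) : Continuous (CGPow.toPi : CGPow X n → Fin n → X) :=
  continuous_from_compactlyGenerated.{u} (X := Fin n → X) (fun x => x) fun _ g => g.continuous

theorem CGPow.continuous_apply {n : ℕ} (i : Fin n) : Continuous (fun x : CGPow X n => x i) :=
  (_root_.continuous_apply (A := fun _ : Fin n => X) i).comp (CGPow.continuous_toPi n)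

theorem CGPow.continuous_of_compHaus {n : ℕ} (K : CompHaus.{u}) (f : K → CGPow X n)
    (hf : ∀ i, Continuous fun k => f k i) : Continuous f := by
  have hf' : Continuous (fun k => (f k).toPi) := continuous_pi hf
  refine continuous_def.2 fun U hU => ?_
  have hU' := isOpen_sigma_iff.1 (isOpen_coinduced.1 hU)
  exact hU' ⟨K, ⟨_, hf'⟩⟩

instance CGPow.instCompactlyGenerated (n : ℕ) : CompactlyGeneratedSpace (CGPow X n) :=
  uCompactlyGeneratedSpace_of_continuous_maps fun f h => by
    refine continuous_from_compactlyGenerated.{u} (X := Fin n → X) f fun S g => ?_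
    exact h S ⟨fun k => g k, continuous_of_compHaus S (fun k => g k)
      fun i => (_root_.continuous_apply i).comp g.continuous⟩

/-- A map from a compactly generated space to the power is continuous as soon as its coordinates
are. -/
theorem CGPow.continuous_of_apply {Z : Type u} [TopologicalSpace Z] [CompactlyGeneratedSpace Z]
    {n : ℕ} (f : Z → CGPow X n) (hf : ∀ i, Continuous fun z => f z i) : Continuous f :=
  continuous_from_uCompactlyGeneratedSpace f fun S g =>
    continuous_of_compHaus S _ fun i => (hf i).comp g.continuous

end CG

/-! ### Pointed homotopy classes -/

section HoClass

/-- Continuous pointed maps `(Z, z₀) → (Y, y₀)`. -/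
def PMap {Z Y : Type u} [TopologicalSpace Z] [TopologicalSpace Y] (z₀ : Z) (y₀ : Y) : Type u :=
  {f : C(Z, Y) // f z₀ = y₀}

/-- Pointed homotopy of pointed maps. -/
def PMap.setoid {Z Y : Type u} [TopologicalSpace Z] [TopologicalSpace Y] (z₀ : Z) (y₀ : Y) :
    Setoid (PMap z₀ y₀) where
  r f g := f.1.HomotopicRel g.1 {z₀}
  iseqv := ⟨fun _ => .refl _, fun h => h.symm, fun h k => h.trans k⟩

/-- The set `[Z, Y]` of pointed homotopy classes of pointed maps `(Z, z₀) → (Y, y₀)`. -/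
def HoClass {Z Y : Type u} [TopologicalSpace Z] [TopologicalSpace Y] (z₀ : Z) (y₀ : Y) : Type u :=
  Quotient (PMap.setoid z₀ y₀)

/-- The homotopy class of a pointed map. -/
def HoClass.mk {Z Y : Type u} [TopologicalSpace Z] [TopologicalSpace Y] {z₀ : Z} {y₀ : Y}
    (f : C(Z, Y)) (hf : f z₀ = y₀) : HoClass z₀ y₀ :=
  Quotient.mk (PMap.setoid z₀ y₀) ⟨f, hf⟩

/-- The base point of `X` is non-degenerate: `(X, x₀)` is an NDR pair. -/
def NondegenerateBasepoint {X : Type u} [TopologicalSpace X] (x₀ : X) : Prop :=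
  ∃ (v : C(X, unitInterval)) (h : C(unitInterval × X, X)),
    (∀ x, v x = 0 ↔ x = x₀) ∧ (∀ x, h (0, x) = x) ∧ (∀ t, h (t, x₀) = x₀) ∧
      ∀ x, v x < 1 → h (1, x) = x₀

/-- `X` has the homotopy type of a CW complex. -/
def HasCWHomotopyType (X : Type u) [TopologicalSpace X] : Prop :=
  ∃ Y : TopCat.{u}, Nonempty (TopCat.CWComplex Y) ∧ Nonempty (ContinuousMap.HomotopyEquiv X Y)

end HoClass

/-! ### Smash powers and weak Lusternik–Schnirelmann category -/

section Smash

variable {X : Type u} [TopologicalSpace X]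

/-- The relation on `X^k` identifying all points having some coordinate equal to the base
point. -/
def smashRel (x₀ : X) (k : ℕ) (a b : CGPow X k) : Prop :=
  (∃ i, a i = x₀) ∧ ∃ j, b j = x₀

/-- The `k`-fold smash power `X^{(k)}`, for `k ≥ 1`. -/
def SmashPow (x₀ : X) (k : ℕ) : Type u := Quot (smashRel x₀ k)

instance (x₀ : X) (k : ℕ) : TopologicalSpace (SmashPow x₀ k) :=
  inferInstanceAs (TopologicalSpace (Quot (smashRel x₀ k)))

/-- The base point of the smash power. -/
def SmashPow.base (x₀ : X) (k : ℕ) : SmashPow x₀ k := Quot.mk _ (fun _ => x₀ : CGPow X k)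

/-- The reduced diagonal `X → X^{(k)}`. -/
def reducedDiagonal [CompactlyGeneratedSpace X] (x₀ : X) (k : ℕ) : C(X, SmashPow x₀ k) where
  toFun x := Quot.mk _ (fun _ => x : CGPow X k)
  continuous_toFun := continuous_quot_mk.comp
    (CGPow.continuous_of_apply (fun x => (fun _ => x : CGPow X k)) fun _ => continuous_id)

/-- `X` has weak LS-category less than `k` if the reduced diagonal `X → X^{(k)}` is (pointed) null
homotopic. -/
def WeakLSCatLT [CompactlyGeneratedSpace X] (x₀ : X) (k : ℕ) : Prop :=
  (reducedDiagonal x₀ k).HomotopicRel (ContinuousMap.const X (SmashPow.base x₀ k)) {x₀}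

end Smash

/-! ### The James construction -/

section James

variable {X : Type u}

/-- The James construction `J(X)`: the free monoid on `X` modulo the single relation that the
base point is the unit. -/
def James (x₀ : X) : Type u :=
  (conGen fun a b : FreeMonoid X => a = FreeMonoid.of x₀ ∧ b = 1).Quotient

variable {x₀ : X}

instance : Monoid (James x₀) :=
  inferInstanceAs (Monoid
    (conGen fun a b : FreeMonoid X => a = FreeMonoid.of x₀ ∧ b = 1).Quotient)

/-- The canonical map `E : X → J(X)` on underlying sets. -/
def James.of (x₀ : X) (x : X) : James x₀ :=
  (conGen fun a b : FreeMonoid X => a = FreeMonoid.of x₀ ∧ b = 1).mk' (FreeMonoid.of x)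

theorem James.of_base : James.of x₀ x₀ = 1 :=
  (Con.eq _).2 (ConGen.Rel.of _ _ ⟨rfl, rfl⟩)

/-- The word `x₁ x₂ ⋯ x_k` in `J(X)`. -/
def James.word (x₀ : X) (p : Σ k, CGPow X k) : James x₀ :=
  (List.ofFn fun i => James.of x₀ (p.2 i)).prod

/-- Concatenation of tuples. -/
def CGPow.append {k l : ℕ} (a : CGPow X k) (b : CGPow X l) : CGPow X (k + l) :=
  Fin.append (α := X) a b

theorem CGPow.append_left {k l : ℕ} (a : CGPow X k) (b : CGPow X l) (i : Fin k) :
    CGPow.append a b (Fin.castAdd l i) = a i := Fin.append_left (α := X) a b i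

theorem CGPow.append_right {k l : ℕ} (a : CGPow X k) (b : CGPow X l) (i : Fin l) :
    CGPow.append a b (Fin.natAdd k i) = b i := Fin.append_right (α := X) a b i

theorem James.word_surjective : Function.Surjective (James.word x₀) := by
  intro w
  obtain ⟨l, rfl⟩ := Con.mk'_surjective w
  refine ⟨⟨(FreeMonoid.toList l).length, fun i => (FreeMonoid.toList l).get i⟩, ?_⟩
  have h : (fun i => James.of x₀ ((FreeMonoid.toList l).get i)) =
      James.of x₀ ∘ (FreeMonoid.toList l).get := rfl
  unfold James.word
  rw [h, ← List.map_ofFn, List.ofFn_get]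
  induction l using FreeMonoid.inductionOn' with
  | one => rfl
  | of_mul x l ih =>
    rw [FreeMonoid.toList_of_mul, List.map_cons, List.prod_cons, ih rfl]
    rfl

theorem James.word_append {k l : ℕ} (a : CGPow X k) (b : CGPow X l) :
    James.word x₀ ⟨k + l, CGPow.append a b⟩ =
      James.word x₀ ⟨k, a⟩ * James.word x₀ ⟨l, b⟩ := by
  have h : (fun i => James.of x₀ (CGPow.append a b i)) =
      Fin.append (fun i => James.of x₀ (a i)) (fun i => James.of x₀ (b i)) := by
    funext i
    refine Fin.addCases (fun i => ?_) (fun i => ?_) i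
    · rw [CGPow.append_left, Fin.append_left]
    · rw [CGPow.append_right, Fin.append_right]
  unfold James.word
  rw [h, List.ofFn_fin_append, List.prod_append]

variable [TopologicalSpace X]

/-- `J(X)` has the quotient topology from the disjoint union of the powers `X^k`. -/
instance : TopologicalSpace (James x₀) :=
  TopologicalSpace.coinduced (James.word x₀) inferInstance

theorem James.continuous_word : Continuous (James.word x₀) := continuous_coinduced_rng

theorem James.continuous_word_mul_word (K L : CompHaus.{u}) {k l : ℕ} (a : C(K, CGPow X k))
    (b : C(L, CGPow X l)) :
    Continuous fun p : K × L => James.word x₀ ⟨k, a p.1⟩ * James.word x₀ ⟨l, b p.2⟩ := by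
  simp only [← James.word_append]
  refine James.continuous_word.comp (continuous_sigmaMk.comp
    (CGPow.continuous_of_compHaus (CompHaus.of (K × L)) _ fun i => ?_))
  refine Fin.addCases (fun i => ?_) (fun i => ?_) i
  · simp only [CGPow.append_left]
    exact (CGPow.continuous_apply i).comp (a.continuous.comp continuous_fst)
  · simp only [CGPow.append_right]
    exact (CGPow.continuous_apply i).comp (b.continuous.comp continuous_snd)

theorem locallyCompactSpace_of_compact_t2 (K : Type u) [TopologicalSpace K] [CompactSpace K]
    [T2Space K] : LocallyCompactSpace K := inferInstance

/-- A family of self-maps of `J(X)` parametrised by a compact space is jointly continuous as soon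
as it is so on all compact families of words. -/
theorem James.continuous_uncurry (K : CompHaus.{u}) (F : K → James x₀ → James x₀)
    (h : ∀ (l : ℕ) (L : CompHaus.{u}) (b : C(L, CGPow X l)),
      Continuous fun p : L × K => F p.2 (James.word x₀ ⟨l, b p.1⟩)) :
    Continuous fun p : James x₀ × K => F p.2 p.1 := by
  have hs : ∀ w : James x₀, Continuous fun c : K => F c w := by
    intro w
    obtain ⟨⟨l, y⟩, rfl⟩ := James.word_surjective w
    exact (h l (CompHaus.of PUnit) (ContinuousMap.const _ y)).comp
      (Continuous.prodMk_right PUnit.unit)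
  let G : James x₀ → C(K, James x₀) := fun w => ⟨_, hs w⟩
  have hG : Continuous G := by
    refine continuous_coinduced_dom.2 (continuous_sigma fun l => ?_)
    refine continuous_from_uCompactlyGeneratedSpace _ fun S q => ?_
    exact ContinuousMap.continuous_of_continuous_uncurry _ (h l S q)
  have : LocallyCompactSpace K := locallyCompactSpace_of_compact_t2 K
  exact ContinuousMap.continuous_uncurry_of_continuous ⟨G, hG⟩

/-- The multiplication of `J(X)` is continuous on compact Hausdorff test spaces. -/
theorem James.continuous_mul_compHaus (K : CompHaus.{u}) (f g : C(K, James x₀)) :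
    Continuous fun κ => f κ * g κ := by
  have A : ∀ (L : CompHaus.{u}) (k : ℕ) (h : C(L, CGPow X k)),
      Continuous fun p : James x₀ × L => James.word x₀ ⟨k, h p.2⟩ * p.1 := fun L k h =>
    James.continuous_uncurry L (fun c w => James.word x₀ ⟨k, h c⟩ * w) fun l M b =>
      (James.continuous_word_mul_word L M h b).comp continuous_swap
  have B : Continuous fun p : James x₀ × K => p.1 * g p.2 :=
    James.continuous_uncurry K (fun c w => w * g c) fun l L b =>
      (A L l b).comp ((g.continuous.comp continuous_snd).prodMk continuous_fst)
  exact B.comp (f.continuous.prodMk continuous_id)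

/-- The pointwise product of maps from a compactly generated space to `J(X)`. -/
def James.mulMap {Z : Type u} [TopologicalSpace Z] [CompactlyGeneratedSpace Z]
    (f g : C(Z, James x₀)) : C(Z, James x₀) where
  toFun z := f z * g z
  continuous_toFun := continuous_from_uCompactlyGeneratedSpace _ fun S q =>
    James.continuous_mul_compHaus S (f.comp q) (g.comp q)

theorem James.mulMap_homotopicRel {Z : Type u} [TopologicalSpace Z] [CompactlyGeneratedSpace Z]
    {f f' g g' : C(Z, James x₀)} {S : Set Z} (hf : f.HomotopicRel f' S)
    (hg : g.HomotopicRel g' S) : (mulMap f g).HomotopicRel (mulMap f' g') S := by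
  obtain ⟨F⟩ := hf
  obtain ⟨G⟩ := hg
  have hc : Continuous fun p : unitInterval × Z => F p * G p := by
    let Φ : Z → C(unitInterval, James x₀) := fun z =>
      ⟨fun t => F (t, z) * G (t, z), by
        have := James.continuous_mul_compHaus (CompHaus.of (ULift.{u} unitInterval))
          ⟨fun t => F (t.down, z), by fun_prop⟩ ⟨fun t => G (t.down, z), by fun_prop⟩
        exact this.comp continuous_uliftUp⟩
    have hΦ : Continuous Φ := by
      refine continuous_from_uCompactlyGeneratedSpace _ fun S q => ?_
      refine ContinuousMap.continuous_of_continuous_uncurry _ ?_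
      exact James.continuous_mul_compHaus (CompHaus.of (S × unitInterval))
        ⟨fun p => F (p.2, q p.1), by fun_prop⟩ ⟨fun p => G (p.2, q p.1), by fun_prop⟩
    exact (ContinuousMap.continuous_uncurry_of_continuous ⟨Φ, hΦ⟩).comp continuous_swap
  exact ⟨{ toFun := fun p => F p * G p
           continuous_toFun := hc
           map_zero_left := fun z => by simp [mulMap]
           map_one_left := fun z => by simp [mulMap]
           prop' := fun t z hz => by
            change F (t, z) * G (t, z) = f z * g z
            rw [F.eq_fst t hz, G.eq_fst t hz] }⟩

/-- The multiplication of homotopy classes of maps to `J(X)`, induced by the multiplication of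
`J(X)`. -/
instance {Z : Type u} [TopologicalSpace Z] [CompactlyGeneratedSpace Z] (z₀ : Z) :
    Monoid (HoClass z₀ (1 : James x₀)) where
  mul := Quotient.map₂
    (fun f g => ⟨James.mulMap f.1 g.1, by simp [James.mulMap, f.2, g.2]⟩)
    (fun _ _ hf _ _ hg => James.mulMap_homotopicRel hf hg)
  one := HoClass.mk (ContinuousMap.const Z 1) rfl
  mul_assoc := by
    rintro ⟨f⟩ ⟨g⟩ ⟨h⟩
    exact congrArg (Quotient.mk _) (Subtype.ext (ContinuousMap.ext fun z => mul_assoc _ _ _))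
  one_mul := by
    rintro ⟨f⟩
    exact congrArg (Quotient.mk _) (Subtype.ext (ContinuousMap.ext fun z => one_mul _))
  mul_one := by
    rintro ⟨f⟩
    exact congrArg (Quotient.mk _) (Subtype.ext (ContinuousMap.ext fun z => mul_one _))

/-- The homomorphism `q^* : [Y, J(X)] → [Z, J(X)]` induced by a pointed map `q : Z → Y`. -/
def HoClass.precomp {Z Y : Type u} [TopologicalSpace Z] [CompactlyGeneratedSpace Z]
    [TopologicalSpace Y] [CompactlyGeneratedSpace Y] {z₀ : Z} {y₀ : Y} (q : C(Z, Y))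
    (hq : q z₀ = y₀) : HoClass y₀ (1 : James x₀) →* HoClass z₀ (1 : James x₀) where
  toFun := Quotient.map (fun f => ⟨f.1.comp q, by simp [hq, f.2]⟩) (by
    rintro ⟨f, hf⟩ ⟨g, hg⟩ ⟨H⟩
    exact ⟨{ toFun := fun p => H (p.1, q p.2)
             continuous_toFun := by fun_prop
             map_zero_left := fun z => by simp
             map_one_left := fun z => by simp
             prop' := fun t z hz => by
              rw [Set.mem_singleton_iff] at hz
              subst hz
              exact H.eq_fst t hq }⟩)
  map_one' := rfl
  map_mul' := by
    rintro ⟨f⟩ ⟨g⟩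
    rfl

/-- The continuous map `E : X → J(X)`. -/
def James.E [CompactlyGeneratedSpace X] (x₀ : X) : C(X, James x₀) where
  toFun := James.of x₀
  continuous_toFun := by
    have h : James.of x₀ = fun x => James.word x₀ ⟨1, (fun _ => x : Fin 1 → X)⟩ := by
      funext x
      simp [James.word]
    rw [h]
    exact James.continuous_word.comp (continuous_sigmaMk.comp
      (CGPow.continuous_of_apply (fun x => (fun _ => x : CGPow X 1)) fun _ => continuous_id))

/-! ### The James filtration -/

/-- The base point of `X^n`. -/
def CGPow.base (x₀ : X) (n : ℕ) : CGPow X n := fun _ => x₀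

/-- The inclusion `i_j : X^n → X^{n+1}` inserting the base point in the `j`-th place. -/
def CGPow.incl (x₀ : X) {n : ℕ} (j : Fin (n + 1)) (y : CGPow X n) : CGPow X (n + 1) :=
  Fin.insertNth (α := fun _ => X) j x₀ y

/-- The relation on `X^n` identifying `i_j(y)` and `i_k(y)` for all `y ∈ X^{n-1}` and all
`j`, `k`. -/
inductive jamesFilRel (x₀ : X) : (n : ℕ) → CGPow X n → CGPow X n → Prop
  | move {n : ℕ} (j k : Fin (n + 1)) (y : CGPow X n) :
      jamesFilRel x₀ (n + 1) (CGPow.incl x₀ j y) (CGPow.incl x₀ k y)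

/-- The `n`-th stage `J_n(X)` of the James filtration: the coequalizer of the inclusions
`i_j : X^{n-1} → X^n`. -/
def JamesFil (x₀ : X) (n : ℕ) : Type u := Quot (jamesFilRel x₀ n)

instance (n : ℕ) : TopologicalSpace (JamesFil x₀ n) :=
  inferInstanceAs (TopologicalSpace (Quot (jamesFilRel x₀ n)))

/-- The quotient map `q_n : X^n → J_n(X)`. -/
def JamesFil.q (x₀ : X) (n : ℕ) : C(CGPow X n, JamesFil x₀ n) where
  toFun := Quot.mk _
  continuous_toFun := continuous_quot_mk

instance (n : ℕ) : CompactlyGeneratedSpace (JamesFil x₀ n) :=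
  uCompactlyGeneratedSpace_of_coinduced (JamesFil.q x₀ n).continuous rfl

/-- The base point of `J_n(X)`. -/
def JamesFil.base (x₀ : X) (n : ℕ) : JamesFil x₀ n := JamesFil.q x₀ n (CGPow.base x₀ n)

/-- The homomorphism `q_n^* : [J_n(X), J(X)] → [X^n, J(X)]`. -/
def qStar (x₀ : X) (n : ℕ) : HoClass (JamesFil.base x₀ n) (1 : James x₀) →*
    HoClass (CGPow.base x₀ n) (1 : James x₀) :=
  HoClass.precomp (JamesFil.q x₀ n) rfl

/-! ### The geometric groups -/

/-- The class `x_i ∈ [X^n, J(X)]` of the composite `X^n → X → J(X)` of the `i`-th coordinate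
projection and `E`. -/
def xClass [CompactlyGeneratedSpace X] (x₀ : X) {n : ℕ} (i : Fin n) : HoClass (CGPow.base x₀ n) (1 : James x₀) :=
  HoClass.mk ((James.E x₀).comp ⟨fun x => x i, CGPow.continuous_apply i⟩) James.of_base

/-- `K_n(X)`: the subgroup of (invertible elements of) `[X^n, J(X)]` generated by the `x_i`. -/
def geomK [CompactlyGeneratedSpace X] (x₀ : X) (n : ℕ) : Submonoid (HoClass (CGPow.base x₀ n) (1 : James x₀)) :=
  (Subgroup.closure {a : (HoClass (CGPow.base x₀ n) (1 : James x₀))ˣ |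
    ∃ i, (a : HoClass (CGPow.base x₀ n) (1 : James x₀)) = xClass x₀ i}).toSubmonoid.map
      (Units.coeHom _)

/-- `H_n(X) = [J_n(X), J(X)] ∩ K_n(X)`: the classes in `[J_n(X), J(X)]` whose image under `q_n^*`
lies in `K_n(X)`. -/
def geomH [CompactlyGeneratedSpace X] (x₀ : X) (n : ℕ) : Submonoid (HoClass (JamesFil.base x₀ n) (1 : James x₀)) :=
  (geomK x₀ n).comap (qStar x₀ n)

end James

/-!
In weak category less than `2`, a map on `X^k` that is trivial on the fat wedge becomes null
homotopic once two of its arguments are set equal, because the pair of them then factors through the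
reduced diagonal. Iterated commutators of distinct `x_i` are of this kind, so those with a repeated
entry vanish in `[X^n, J(X)]`; the power relations of `K_n` follow from this by pure algebra.

Since `X` is path connected and has the homotopy type of a CW complex, `E : X → J(X)` has a left
inverse up to homotopy, built by extending over cells a lift of `E` to the space of paths from
`y * m` to `1`. Extending it to `J(X)` by an antihomomorphism inverts `J(X)` up to homotopy.

The James–Hopf construction extends a map `X^k → J(X)` that is trivial on the fat wedge to `J_n(X)`,
as the product of its values on all subwords of length `k`. Dividing by such maps for `k = 1, …, n`
in turn shows that `q_n^*` is injective, and that its image is the equalizer of the faces.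
-/

section Commutators

variable {G ι : Type*} [Group G]

theorem rightComm_eq_one_iff {a b : G} : rightComm a b = 1 ↔ Commute a b := by
  rw [rightComm, mul_assoc, ← mul_inv_rev, inv_mul_eq_one, eq_comm, Commute, SemiconjBy]

theorem mul_rightComm (a b : G) : a * rightComm a b = b⁻¹ * a * b := by
  simp [rightComm, mul_assoc]

theorem mul_inv_rightComm {a b : G} (h : Commute (rightComm a b) b) :
    a * (rightComm a b)⁻¹ = b * a * b⁻¹ := by
  have conj_comm : b * rightComm a b * b⁻¹ = rightComm a b := by
    rw [h.symm.eq, mul_inv_cancel_right]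
  rw [mul_inv_eq_iff_eq_mul, ← conj_comm]
  simp [rightComm, mul_assoc]

theorem rightComm_zpow_zpow {a b : G} (ha : Commute a (rightComm a b))
    (hb : Commute (rightComm a b) b) (m k : ℤ) :
    rightComm (a ^ m) (b ^ k) = rightComm a b ^ (m * k) := by
  have conj_left : SemiconjBy a b (b * rightComm a b) := by
    rw [SemiconjBy, mul_assoc, ← ha.eq, mul_rightComm]
    group
  have conj_right : (b ^ k)⁻¹ * a * b ^ k = a * rightComm a b ^ k := by
    rw [mul_assoc, (conj_left.zpow_right k).eq, hb.symm.mul_zpow, mul_assoc, inv_mul_cancel_left,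
      (ha.zpow_right k).eq]
  have conj_zpow_right : (b ^ k)⁻¹ * a ^ m * b ^ k = (a * rightComm a b ^ k) ^ m := by
    simpa only [← conj_right, inv_inv] using (conj_zpow (i := m) (a := (b ^ k)⁻¹) (b := a)).symm
  rw [rightComm, mul_assoc, mul_assoc, ← mul_assoc (b ^ k)⁻¹, conj_zpow_right,
    (ha.zpow_right k).mul_zpow, inv_mul_cancel_left, ← zpow_mul, mul_comm]

theorem iterComm_snoc (x : ι → G) {l : ℕ} (c : Fin (l + 1) → ι) (j : ι) :
    (iterComm (l + 1) fun s => x ((Fin.snoc c j : Fin (l + 2) → ι) s)) =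
      rightComm (iterComm l fun s => x (c s)) (x j) := by
  simp [iterComm]

/-- The left-normed iterated commutators, of any length, in members of the family `x` whose first
entry is `x i`. -/
def leftNormedFrom (x : ι → G) (i : ι) : Set G :=
  {g | ∃ (l : ℕ) (c : Fin (l + 1) → ι), c 0 = i ∧ g = iterComm l fun s => x (c s)}

theorem rightComm_mem_leftNormedFrom {x : ι → G} {i : ι} {g : G} (hg : g ∈ leftNormedFrom x i)
    (j : ι) : rightComm g (x j) ∈ leftNormedFrom x i := by
  obtain ⟨l, c, hc, rfl⟩ := hg
  exact ⟨l + 1, Fin.snoc c j, by rw [← hc, ← Fin.castSucc_zero, Fin.snoc_castSucc],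
    (iterComm_snoc x c j).symm⟩

theorem leftNormedFrom_induction {x : ι → G} {i : ι} {p : G → Prop} (base : p (x i))
    (comm : ∀ g ∈ leftNormedFrom x i, p g → ∀ j, p (rightComm g (x j))) :
    ∀ g ∈ leftNormedFrom x i, p g := by
  rintro g ⟨l, c, hc, rfl⟩
  induction l with
  | zero => simpa [iterComm, hc] using base
  | succ l ih =>
    exact comm _ ⟨l, _, by simpa using hc, rfl⟩ (ih (fun s => c s.castSucc) (by simpa using hc))
      (c (Fin.last _))

section Vanishing

variable {x : ι → G} (hx : ∀ (l : ℕ) (c : Fin (l + 1) → ι), (∃ s t, s < t ∧ c s = c t) →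
  (iterComm l fun s => x (c s)) = 1)

include hx

theorem commute_iterComm_of_mem_range (l : ℕ) (c : Fin (l + 1) → ι) (s : Fin (l + 1)) :
    Commute (iterComm l fun s => x (c s)) (x (c s)) := by
  rw [← rightComm_eq_one_iff, ← iterComm_snoc]
  exact hx _ _ ⟨s.castSucc, Fin.last _, Fin.castSucc_lt_last _, by
    rw [Fin.snoc_castSucc, Fin.snoc_last]⟩

theorem commute_rightComm_of_mem_leftNormedFrom {i : ι} {g : G} (hg : g ∈ leftNormedFrom x i)
    (j : ι) : Commute (rightComm g (x j)) (x j) := by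
  obtain ⟨l, c, -, rfl⟩ := hg
  simpa only [iterComm_snoc, Fin.snoc_last] using
    commute_iterComm_of_mem_range hx (l + 1) (Fin.snoc c j) (Fin.last _)

theorem mem_normalizer_closure_leftNormedFrom (i j : ι) :
    x j ∈ Subgroup.normalizer (Subgroup.closure (leftNormedFrom x i) : Set G) := by
  have map_le : ∀ y : G, (∀ g ∈ leftNormedFrom x i,
      y * g * y⁻¹ ∈ Subgroup.closure (leftNormedFrom x i)) →
      ∀ g ∈ Subgroup.closure (leftNormedFrom x i),
        y * g * y⁻¹ ∈ Subgroup.closure (leftNormedFrom x i) := fun y hy =>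
    (Subgroup.closure_le ((Subgroup.closure _).comap (MulAut.conj y).toMonoidHom)).2 hy
  have conj_mem := map_le (x j) fun g hg => by
    rw [← mul_inv_rightComm (commute_rightComm_of_mem_leftNormedFrom hx hg j)]
    exact mul_mem (Subgroup.subset_closure hg)
      (inv_mem (Subgroup.subset_closure (rightComm_mem_leftNormedFrom hg j)))
  have conj_inv_mem := map_le (x j)⁻¹ fun g hg => by
    rw [inv_inv, ← mul_rightComm]
    exact mul_mem (Subgroup.subset_closure hg)
      (Subgroup.subset_closure (rightComm_mem_leftNormedFrom hg j))
  refine Subgroup.mem_normalizer_iff.2 fun g => ⟨conj_mem g, fun hg => ?_⟩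
  simpa [mul_assoc] using conj_inv_mem _ hg

theorem commute_of_mem_leftNormedFrom {i : ι} {g h : G} (hg : g ∈ leftNormedFrom x i)
    (hh : h ∈ leftNormedFrom x i) : Commute g h := by
  suffices ∀ g ∈ leftNormedFrom x i, ∀ h ∈ Subgroup.closure (leftNormedFrom x i), Commute g h from
    this g hg h (Subgroup.subset_closure hh)
  refine leftNormedFrom_induction ?_ fun g _ ih j h hh => ?_
  · have : Subgroup.closure (leftNormedFrom x i) ≤ Subgroup.centralizer {x i} := by
      refine (Subgroup.closure_le _).2 ?_
      rintro _ ⟨l, c, rfl, rfl⟩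
      exact Subgroup.mem_centralizer_singleton_iff.2 (commute_iterComm_of_mem_range hx l c 0).eq
    exact fun h hh => (Subgroup.mem_centralizer_singleton_iff.1 (this hh)).symm
  · have conj_commute : Commute ((x j)⁻¹ * g * x j) h := by
      have := ih _
        ((Subgroup.mem_normalizer_iff.1 (mem_normalizer_closure_leftNormedFrom hx i j) h).1 hh)
      simpa [mul_assoc] using this.conj (x j)⁻¹
    rw [show rightComm g (x j) = g⁻¹ * ((x j)⁻¹ * g * x j) by simp [rightComm, mul_assoc]]
    exact (ih h hh).inv_left.mul_left conj_commute

theorem iterComm_zpow (l : ℕ) (c : Fin (l + 1) → ι) (m : Fin (l + 1) → ℤ) :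
    (iterComm l fun s => x (c s) ^ m s) = (iterComm l fun s => x (c s)) ^ ∏ s, m s := by
  induction l with
  | zero => simp [iterComm]
  | succ l ih =>
    have ha : (iterComm l fun s => x (c s.castSucc)) ∈ leftNormedFrom x (c 0) :=
      ⟨l, _, by rw [Fin.castSucc_zero], rfl⟩
    simp only [iterComm, ih fun s => c s.castSucc]
    rw [rightComm_zpow_zpow
      (commute_of_mem_leftNormedFrom hx ha (rightComm_mem_leftNormedFrom ha _))
      (commute_rightComm_of_mem_leftNormedFrom hx ha _), ← Fin.prod_univ_castSucc]

end Vanishing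

end Commutators

section CompactlyGenerated

open unitInterval in
instance compactlyGeneratedSpace_unitInterval_prod {Z : Type u} [TopologicalSpace Z]
    [CompactlyGeneratedSpace Z] : CompactlyGeneratedSpace (I × Z) :=
  uCompactlyGeneratedSpace_of_continuous_maps fun {W} _ f hf => by
    have continuous_slice : ∀ (S : CompHaus.{u}) (q : C(S, Z)),
        Continuous fun p : S × I => f (p.2, q p.1) := fun S q =>
      hf (CompHaus.of (S × I)) ⟨fun p => (p.2, q p.1), by fun_prop⟩
    have continuous_path : ∀ z : Z, Continuous fun t : I => f (t, z) := fun z =>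
      (continuous_slice (CompHaus.of PUnit) (ContinuousMap.const _ z)).comp
        (Continuous.prodMk_right PUnit.unit)
    let G : Z → C(I, W) := fun z => ⟨_, continuous_path z⟩
    have hG : Continuous G := continuous_from_uCompactlyGeneratedSpace _ fun S q =>
      ContinuousMap.continuous_of_continuous_uncurry _ (continuous_slice S q)
    exact (ContinuousMap.continuous_uncurry_of_continuous ⟨G, hG⟩).comp continuous_swap

end CompactlyGenerated

namespace James

variable {X : Type u} {x₀ : X}

/-- The monoid homomorphism out of `J(X)` induced by a map killing the base point. -/
def lift {N : Type*} [Monoid N] (f : X → N) (hf : f x₀ = 1) : James x₀ →* N :=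
  (conGen fun a b : FreeMonoid X => a = FreeMonoid.of x₀ ∧ b = 1).lift (FreeMonoid.lift f)
    (Con.conGen_le.2 (by
      rintro a b ⟨rfl, rfl⟩
      simpa [Con.ker_rel] using hf))

@[simp]
theorem lift_of {N : Type*} [Monoid N] (f : X → N) (hf : f x₀ = 1) (x : X) :
    lift f hf (of x₀ x) = f x :=
  FreeMonoid.lift_eval_of f x

theorem lift_word {N : Type*} [Monoid N] (f : X → N) (hf : f x₀ = 1) (p : Σ k, CGPow X k) :
    lift f hf (word x₀ p) = (List.ofFn fun i => f (p.2 i)).prod := by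
  rw [word, map_list_prod, List.map_ofFn]
  congr 2

variable [TopologicalSpace X]

theorem continuous_mul {Z : Type u} [TopologicalSpace Z] [CompactlyGeneratedSpace Z]
    {f g : Z → James x₀} (hf : Continuous f) (hg : Continuous g) :
    Continuous fun z => f z * g z :=
  (mulMap ⟨f, hf⟩ ⟨g, hg⟩).continuous

theorem continuous_of_comp_word {Y : Type*} [TopologicalSpace Y] {f : James x₀ → Y}
    (h : ∀ k, Continuous fun x : CGPow X k => f (word x₀ ⟨k, x⟩)) : Continuous f :=
  continuous_coinduced_dom.2 (continuous_sigma h)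

theorem continuous_unop_list_prod {Z : Type u} [TopologicalSpace Z] [CompactlyGeneratedSpace Z]
    {k : ℕ} {f : Fin k → Z → James x₀} (hf : ∀ i, Continuous (f i)) :
    Continuous fun z => (List.ofFn fun i => MulOpposite.op (f i z)).prod.unop := by
  induction k with
  | zero => simpa using continuous_const
  | succ k ih =>
    simp only [List.ofFn_succ, List.prod_cons, MulOpposite.unop_mul, MulOpposite.unop_op]
    exact continuous_mul (ih fun i => hf i.succ) (hf 0)

instance [PathConnectedSpace X] : PathConnectedSpace (James x₀) := by
  have h : ∀ w : James x₀, Joined 1 w := by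
    intro w
    obtain ⟨⟨k, x⟩, rfl⟩ := word_surjective w
    have hp : ∀ i, Joined x₀ (x i) := fun i => PathConnectedSpace.joined _ _
    let q : unitInterval → CGPow X k := fun t i => (hp i).somePath t
    have hq : Continuous q := by
      have := CGPow.continuous_of_compHaus (CompHaus.of (ULift.{u} unitInterval))
        (fun t => q t.down) fun i => ((hp i).somePath.continuous.comp continuous_uliftDown)
      exact this.comp continuous_uliftUp
    refine ⟨⟨⟨fun t => word x₀ ⟨k, q t⟩, continuous_word.comp (continuous_sigmaMk.comp hq)⟩,
      ?_, ?_⟩⟩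
    · simp [q, word, of_base]
    · simp [q]
  exact ⟨⟨1⟩, fun a b => (h a).symm.trans (h b)⟩

end James

section LeftInverses

open CategoryTheory Limits HomotopicalAlgebra

theorem hasLiftingProperty_of_relativeCWComplex {A Y T M : TopCat.{u}} {f : A ⟶ Y}
    (c : TopCat.RelativeCWComplex f) (p : T ⟶ M)
    (hp : ∀ n, HasLiftingProperty (TopCat.diskBoundaryInclusion n) p) :
    HasLiftingProperty f p := by
  let W : MorphismProperty TopCat.{u} :=
    MorphismProperty.ofHoms fun n : ℕ => TopCat.diskBoundaryInclusion.{u} n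
  have h := c.transfiniteCompositionOfShape' (I := W) fun s =>
    MorphismProperty.ofHoms_iff _ _ |>.2 ⟨s.j, rfl⟩
  refine MorphismProperty.transfiniteCompositionsOfShape_pushouts_coproducts_le_llp_rlp W ℕ _ h.mem
    p ?_
  rintro _ _ _ ⟨n⟩
  exact hp n

open unitInterval
open scoped TopCat

/-- The center of the disk. -/
def diskCenter (n : ℕ) : TopCat.disk.{u} n := ⟨0, by simp⟩

/-- The point at distance `1 - e` from the center on the ray through a point of the sphere. -/
def diskRay (n : ℕ) : C(I × ∂𝔻 n, TopCat.disk.{u} n) where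
  toFun p := ⟨(1 - (p.1 : ℝ)) • p.2.down.1, by
    rw [mem_closedBall_zero_iff, norm_smul, mem_sphere_zero_iff_norm.1 p.2.down.2, mul_one,
      Real.norm_of_nonneg (sub_nonneg.2 p.1.2.2)]
    exact sub_le_self _ p.1.2.1⟩
  continuous_toFun := by
    refine continuous_uliftUp.comp (Continuous.subtype_mk ?_ _)
    exact (continuous_const.sub (continuous_subtype_val.comp continuous_fst)).smul
      (continuous_subtype_val.comp (continuous_uliftDown.comp continuous_snd))

theorem diskRay_eq_iff {n : ℕ} {e : I} {u : ∂𝔻 n} {z : TopCat.disk.{u} n} :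
    diskRay n (e, u) = z ↔ (1 - (e : ℝ)) • u.down.1 = z.down.1 :=
  ULift.ext_iff.trans Subtype.ext_iff

theorem diskRay_zero {n : ℕ} (u : ∂𝔻 n) :
    diskRay.{u} n (0, u) = TopCat.diskBoundaryInclusion n u := by
  rw [diskRay_eq_iff, Set.Icc.coe_zero, sub_zero, one_smul]
  rfl

theorem diskRay_one {n : ℕ} (u : ∂𝔻 n) : diskRay.{u} n (1, u) = diskCenter n := by
  rw [diskRay_eq_iff, Set.Icc.coe_one, sub_self, zero_smul]
  rfl

theorem diskRay_surjective {n : ℕ} (hn : n ≠ 0) : Function.Surjective (diskRay.{u} n) := by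
  rintro ⟨⟨z, hz⟩⟩
  have norm_le : ‖z‖ ≤ 1 := mem_closedBall_zero_iff.1 hz
  have : NeZero n := ⟨hn⟩
  rcases eq_or_ne z 0 with rfl | h0
  · obtain ⟨w, hw⟩ := (NormedSpace.sphere_nonempty (E := EuclideanSpace ℝ (Fin n)) (x := 0)
      (r := 1)).2 zero_le_one
    exact ⟨⟨1, ⟨⟨w, hw⟩⟩⟩, diskRay_one _⟩
  · have norm_ne : ‖z‖ ≠ 0 := norm_ne_zero_iff.2 h0
    refine ⟨⟨⟨1 - ‖z‖, by linarith, by linarith [norm_nonneg z]⟩,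
      ⟨⟨‖z‖⁻¹ • z, by simp [norm_smul, norm_ne]⟩⟩⟩, diskRay_eq_iff.2 ?_⟩
    simp [smul_smul, norm_ne]

theorem isQuotientMap_diskRay {n : ℕ} (hn : n ≠ 0) : IsQuotientMap (diskRay.{u} n) := by
  have : CompactSpace (∂𝔻 n) := inferInstanceAs (CompactSpace (ULift (Metric.sphere _ _)))
  have : T2Space (TopCat.disk.{u} n) := inferInstanceAs (T2Space (ULift (Metric.closedBall _ _)))
  exact IsQuotientMap.of_surjective_continuous (diskRay_surjective hn) (diskRay n).continuous

theorem eq_of_diskRay_eq {n : ℕ} {e e' : I} {u v : ∂𝔻 n}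
    (h : diskRay.{u} n (e, u) = diskRay n (e', v)) : e = e' ∧ (e = 1 ∨ u = v) := by
  obtain ⟨⟨u, hu⟩⟩ := u
  obtain ⟨⟨v, hv⟩⟩ := v
  have smul_eq : (1 - (e : ℝ)) • u = (1 - (e' : ℝ)) • v := diskRay_eq_iff.1 h
  have norm_eq := congrArg norm smul_eq
  rw [norm_smul, norm_smul, mem_sphere_zero_iff_norm.1 hu, mem_sphere_zero_iff_norm.1 hv, mul_one,
    mul_one, Real.norm_of_nonneg (sub_nonneg.2 e.2.2), Real.norm_of_nonneg (sub_nonneg.2 e'.2.2)]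
    at norm_eq
  obtain rfl : e = e' := Subtype.ext (sub_right_injective norm_eq)
  refine ⟨rfl, or_iff_not_imp_left.2 fun he => ?_⟩
  obtain rfl := smul_right_injective _ (sub_ne_zero.2 fun h => he (Subtype.ext h.symm)) smul_eq
  rfl

theorem exists_extension_of_diskRay {T : Type*} [TopologicalSpace T] {n : ℕ} (hn : n ≠ 0)
    (Ψ : C(I × ∂𝔻 n, T)) (h : ∀ u v, Ψ (1, u) = Ψ (1, v)) :
    ∃ Φ : C(TopCat.disk.{u} n, T), ∀ p, Φ (diskRay n p) = Ψ p := by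
  have factors : Function.FactorsThrough Ψ (diskRay n) := by
    rintro ⟨e, u⟩ ⟨e', v⟩ huv
    obtain ⟨rfl, rfl | rfl⟩ := eq_of_diskRay_eq huv
    exacts [h u v, rfl]
  exact ⟨(isQuotientMap_diskRay hn).lift Ψ factors,
    DFunLike.congr_fun ((isQuotientMap_diskRay hn).lift_comp Ψ factors)⟩

theorem exists_path_along_diskRay {Y : Type*} [TopologicalSpace Y] [PathConnectedSpace Y] {n : ℕ}
    (f : C(TopCat.disk.{u} n, Y)) (y₀ : Y) :
    ∃ δ : ℝ × ∂𝔻 n → Y, Continuous δ ∧ (∀ e : I, ∀ u, δ (e, u) = f (diskRay n (e, u))) ∧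
      (∀ s u, 2 ≤ s → δ (s, u) = y₀) ∧ ∀ s u v, 1 ≤ s → δ (s, u) = δ (s, v) := by
  let c : Path (f (diskCenter n)) y₀ := PathConnectedSpace.somePath _ _
  let δ : ℝ × ∂𝔻 n → Y := fun p =>
    if p.1 ≤ 1 then f (diskRay n (Set.projIcc 0 1 zero_le_one p.1, p.2)) else c.extend (p.1 - 1)
  have δ_of_one_le : ∀ s u, 1 ≤ s → δ (s, u) = c.extend (s - 1) := fun s u hs => by
    rcases hs.eq_or_lt with rfl | hs
    · simp [δ, diskRay_one]
    · exact if_neg hs.not_ge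
  refine ⟨δ, ?_, fun e u => ?_, fun s u hs => ?_, fun s u v hs => ?_⟩
  · refine Continuous.if_le (by fun_prop) (by fun_prop) continuous_fst continuous_const ?_
    rintro ⟨s, u⟩ rfl
    simp [diskRay_one]
  · simp only [δ, if_pos e.2.2, Set.projIcc_val]
  · rw [δ_of_one_le s u (one_le_two.trans hs), c.extend_of_one_le (by linarith)]
  · rw [δ_of_one_le s u hs, δ_of_one_le s v hs]

end LeftInverses

section Homotopies

open unitInterval

variable {W Z Y : Type*} [TopologicalSpace W] [TopologicalSpace Z] [TopologicalSpace Y]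
  {f g : C(Z, Y)} {S : Set Z}

theorem homotopicRel_of_map (F : I × Z → Y) (hF : Continuous F) (h0 : ∀ z, F (0, z) = f z)
    (h1 : ∀ z, F (1, z) = g z) (hS : ∀ t, ∀ z ∈ S, F (t, z) = f z) : f.HomotopicRel g S :=
  ⟨{ toFun := F
     continuous_toFun := hF
     map_zero_left := h0
     map_one_left := h1
     prop' := hS }⟩

theorem homotopicRel_mono {T : Set Z} (h : f.HomotopicRel g S) (hT : T ⊆ S) :
    f.HomotopicRel g T := by
  obtain ⟨F⟩ := h
  exact homotopicRel_of_map F F.continuous (fun z => by simp) (fun z => by simp)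
    fun t z hz => F.eq_fst t (hT hz)

theorem homotopicRel_comp_right (h : f.HomotopicRel g S) (k : C(W, Z)) {T : Set W}
    (hk : Set.MapsTo k T S) : (f.comp k).HomotopicRel (g.comp k) T := by
  obtain ⟨F⟩ := h
  exact homotopicRel_of_map (fun p => F (p.1, k p.2)) (by fun_prop) (fun z => by simp)
    (fun z => by simp) fun t z hz => F.eq_fst t (hk hz)

end Homotopies

namespace James

open unitInterval

variable {X : Type u} [TopologicalSpace X] (x₀ : X)

/-- Triples `(m, y, γ)` with `γ` a path in `J(X)` from `y * m` to `1`: witnesses that `y` is a left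
inverse of `m` up to homotopy. -/
abbrev LeftInv : Type u :=
  {q : James x₀ × James x₀ × C(I, James x₀) // q.2.2 0 = q.2.1 * q.1 ∧ q.2.2 1 = 1}

variable {x₀}

theorem continuous_toLeftInv {Z : Type*} [TopologicalSpace Z] {m y : Z → James x₀}
    {P : I × Z → James x₀} (hm : Continuous m) (hy : Continuous y) (hP : Continuous P)
    (h0 : ∀ z, P (0, z) = y z * m z) (h1 : ∀ z, P (1, z) = 1) :
    Continuous fun z => (⟨(m z, y z, ⟨fun s => P (s, z), by fun_prop⟩), h0 z, h1 z⟩ :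
      LeftInv x₀) :=
  Continuous.subtype_mk (hm.prodMk (hy.prodMk
    (ContinuousMap.continuous_of_continuous_uncurry
      (fun z => (⟨fun s => P (s, z), by fun_prop⟩ : C(I, James x₀)))
      (hP.comp continuous_swap)))) _

theorem LeftInv.ext {a b : LeftInv x₀} (base : a.1.1 = b.1.1) (inv : a.1.2.1 = b.1.2.1)
    (path : ∀ s, a.1.2.2 s = b.1.2.2 s) : a = b :=
  Subtype.ext (Prod.ext base (Prod.ext inv (ContinuousMap.ext path)))

theorem LeftInv.exists_transport {Z : Type u} [TopologicalSpace Z] [CompactlyGeneratedSpace Z]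
    (ψ : C(Z, LeftInv x₀)) {μ : ℝ × Z → James x₀} (hμ : Continuous μ)
    (hμψ : ∀ z, μ (0, z) = (ψ z).1.1) {L : Z → ℝ} (hL : Continuous L) (hL0 : ∀ z, 0 ≤ L z) :
    ∃ Φ : C(Z, LeftInv x₀), (∀ z, (Φ z).1.1 = μ (L z, z)) ∧ (∀ z, L z = 0 → Φ z = ψ z) ∧
      ∀ z z', ψ z = ψ z' → L z = L z' → (∀ s ∈ Set.Icc 0 (L z), μ (s, z) = μ (s, z')) →
        Φ z = Φ z' := by
  let P : I × Z → James x₀ := fun p =>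
    if p.1 * (1 + L p.2) ≤ L p.2 then (ψ p.2).1.2.1 * μ (L p.2 - p.1 * (1 + L p.2), p.2)
    else (ψ p.2).1.2.2 (Set.projIcc 0 1 zero_le_one (p.1 * (1 + L p.2) - L p.2))
  have P_zero : ∀ z, P (0, z) = (ψ z).1.2.1 * μ (L z, z) := fun z => by simp [P, hL0 z]
  have P_one : ∀ z, P (1, z) = 1 := fun z => by simp [P, (ψ z).2.2]
  have continuous_P : Continuous P := by
    refine Continuous.if_le (continuous_mul (by fun_prop) (by fun_prop)) ?_ (by fun_prop)
      (by fun_prop) fun p hp => ?_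
    · have : Continuous fun p : I × Z => (ψ p.2).1.2.2 := by fun_prop
      exact this.eval (by fun_prop)
    · simp [hp, hμψ, (ψ p.2).2.1]
  refine ⟨⟨_, continuous_toLeftInv (by fun_prop) (by fun_prop) continuous_P P_zero P_one⟩,
    fun z => rfl, fun z hz => LeftInv.ext ?_ rfl fun s => ?_, fun z z' hψ hLz hμz =>
      LeftInv.ext ?_ ?_ fun s => ?_⟩
  · simp [hz, hμψ]
  · rcases s.2.1.eq_or_lt with hs | hs
    · obtain rfl : s = 0 := Subtype.ext hs.symm
      simp [P, hz, hμψ, (ψ z).2.1]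
    · simp [P, hz, hs.not_ge]
  · simp only [ContinuousMap.coe_mk, ← hLz, hμz _ ⟨hL0 z, le_rfl⟩]
  · simp only [ContinuousMap.coe_mk, hψ]
  · simp only [ContinuousMap.coe_mk, P, ← hLz, ← hψ]
    refine if_ctx_congr Iff.rfl (fun hs => ?_) fun _ => rfl
    rw [hμz _ ⟨sub_nonneg.2 hs, sub_le_self _ (mul_nonneg s.2.1 (by linarith [hL0 z]))⟩]

theorem LeftInv.exists_homotopy_const {Z : Type*} [TopologicalSpace Z] (φ : C(Z, LeftInv x₀))
    (hφ : ∀ z, (φ z).1.1 = 1) :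
    ∃ (q : LeftInv x₀) (C : φ.Homotopy (ContinuousMap.const Z q)), ∀ p, (C p).1.1 = 1 := by
  let P : I × (I × Z) → James x₀ := fun p => (φ p.2.2).1.2.2 (max p.1 p.2.1)
  have continuous_path : Continuous fun z => (φ z).1.2.2 := by fun_prop
  have continuous_P : Continuous P :=
    (continuous_path.comp (continuous_snd.comp continuous_snd)).eval
      (continuous_fst.max (continuous_fst.comp continuous_snd))
  have P_zero : ∀ p : I × Z, P (0, p) = (φ p.2).1.2.2 p.1 * 1 := fun p => by simp [P]
  have P_one : ∀ p, P (1, p) = 1 := fun p =>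
    (congrArg (φ p.2).1.2.2 (max_eq_left p.1.2.2)).trans (φ p.2).2.2
  refine ⟨⟨(1, 1, ContinuousMap.const I 1), by simp⟩,
    { toFun := fun p => ⟨(1, (φ p.2).1.2.2 p.1, ⟨fun s => P (s, p), by fun_prop⟩),
        P_zero p, P_one p⟩
      continuous_toFun := continuous_toLeftInv continuous_const
        ((continuous_path.comp continuous_snd).eval continuous_fst) continuous_P P_zero P_one
      map_zero_left := fun z => LeftInv.ext (hφ z).symm ?_ fun s => ?_
      map_one_left := fun z => LeftInv.ext rfl (φ z).2.2 fun s => ?_ }, fun p => rfl⟩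
  · simpa [hφ z] using (φ z).2.1
  · simp [P]
  · exact (congrArg (φ z).1.2.2 (max_eq_right s.2.2)).trans (φ z).2.2

theorem LeftInv.exists_extension_cone {S : Type u} [TopologicalSpace S] [CompactlyGeneratedSpace S]
    (ψ : C(S, LeftInv x₀)) {δ : ℝ × S → James x₀} (hδ : Continuous δ)
    (hψδ : ∀ u, (ψ u).1.1 = δ (0, u)) (hδ2 : ∀ s u, 2 ≤ s → δ (s, u) = 1)
    (hδ1 : ∀ s u v, 1 ≤ s → δ (s, u) = δ (s, v)) :
    ∃ Ψ : C(I × S, LeftInv x₀), (∀ u, Ψ (0, u) = ψ u) ∧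
      (∀ (e : I) (u : S), (Ψ (e, u)).1.1 = δ (e, u)) ∧ ∀ u v, Ψ (1, u) = Ψ (1, v) := by
  -- Transport `ψ` along `δ` and contract: the result lies over `δ (4 * e, u)`.
  obtain ⟨T, T_base, T_zero, -⟩ := exists_transport (ψ.comp (ContinuousMap.snd : C(I × S, S)))
    (μ := fun p => δ (p.1, p.2.2)) (by fun_prop) (fun p => (hψδ p.2).symm)
    (L := fun p => 2 * p.1) (by fun_prop) fun p => mul_nonneg zero_le_two p.1.2.1
  let T₁ : C(S, LeftInv x₀) := ⟨fun u => T (1, u), by fun_prop⟩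
  obtain ⟨q, C, C_base⟩ := exists_homotopy_const T₁ fun u => (T_base _).trans
      (hδ2 _ _ (by simp))
  let T' : ψ.Homotopy T₁ :=
    { toFun := T
      continuous_toFun := T.continuous
      map_zero_left := fun u => T_zero (0, u) (by simp)
      map_one_left := fun u => rfl }
  have trans_base : ∀ p : I × S, (T'.trans C p).1.1 = δ (4 * p.1, p.2) := by
    rintro ⟨e, u⟩
    rw [ContinuousMap.Homotopy.trans_apply]
    split_ifs with he
    · refine (T_base _).trans (congrArg (fun r => δ (r, u)) ?_)
      change 2 * (2 * (e : ℝ)) = 4 * e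
      ring
    · rw [C_base, hδ2 _ _ (by dsimp only at he ⊢; linarith)]
  -- Transport back along `δ` from `4 * e` to `e`.
  obtain ⟨Ψ, Ψ_base, Ψ_zero, Ψ_congr⟩ := exists_transport (T'.trans C).toContinuousMap
    (μ := fun p => δ (4 * p.2.1 - p.1, p.2.2)) (by fun_prop)
    (fun p => by rw [sub_zero]; exact (trans_base p).symm)
    (L := fun p => 3 * p.1) (by fun_prop) fun p => mul_nonneg (by norm_num) p.1.2.1
  refine ⟨Ψ, fun u => ?_, fun e u => ?_, fun u v => Ψ_congr _ _ ?_ rfl fun s hs => hδ1 _ _ _ ?_⟩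
  · exact (Ψ_zero (0, u) (by simp)).trans ((T'.trans C).map_zero_left u)
  · refine (Ψ_base _).trans (congrArg (fun r => δ (r, u)) ?_)
    change 4 * (e : ℝ) - 3 * e = e
    ring
  · exact ((T'.trans C).map_one_left u).trans ((T'.trans C).map_one_left v).symm
  · have : s ≤ 3 * (1 : ℝ) := hs.2
    change (1 : ℝ) ≤ 4 * (1 : ℝ) - s
    linarith

theorem LeftInv.exists_extension_disk [CompactlyGeneratedSpace X] [PathConnectedSpace X] (n : ℕ)
    (ψ : C(TopCat.diskBoundary.{u} n, LeftInv x₀)) (f : C(TopCat.disk.{u} n, James x₀))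
    (h : ∀ u, (ψ u).1.1 = f (diskRay n (0, u))) :
    ∃ Φ : C(TopCat.disk.{u} n, LeftInv x₀),
      (∀ u, Φ (diskRay n (0, u)) = ψ u) ∧ ∀ z, (Φ z).1.1 = f z := by
  rcases eq_or_ne n 0 with rfl | hn
  · have disk_eq : ∀ z, z = diskCenter 0 := fun z =>
      ULift.ext _ _ (Subtype.ext (Subsingleton.elim (α := EuclideanSpace ℝ (Fin 0)) _ _))
    let c : Path (f (diskCenter 0)) 1 := PathConnectedSpace.somePath _ _
    refine ⟨ContinuousMap.const _ ⟨(f (diskCenter 0), 1, c), by simp, by simp⟩, fun u => ?_,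
      fun z => congrArg f (disk_eq z).symm⟩
    have norm_eq := mem_sphere_zero_iff_norm.1 u.down.2
    rw [Subsingleton.elim (α := EuclideanSpace ℝ (Fin 0)) u.down.1 0, norm_zero] at norm_eq
    exact (zero_ne_one norm_eq).elim
  · have : CompactSpace (TopCat.diskBoundary.{u} n) :=
      inferInstanceAs (CompactSpace (ULift (Metric.sphere _ _)))
    have : T2Space (TopCat.diskBoundary.{u} n) :=
      inferInstanceAs (T2Space (ULift (Metric.sphere _ _)))
    obtain ⟨δ, continuous_δ, δ_eq, δ_of_two_le, δ_congr⟩ := exists_path_along_diskRay f 1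
    obtain ⟨Ψ, Ψ_zero, Ψ_base, Ψ_one⟩ := exists_extension_cone ψ continuous_δ
      (fun u => (h u).trans (δ_eq 0 u).symm) δ_of_two_le δ_congr
    obtain ⟨Φ, hΦ⟩ := exists_extension_of_diskRay hn Ψ Ψ_one
    refine ⟨Φ, fun u => (hΦ _).trans (Ψ_zero u), fun z => ?_⟩
    obtain ⟨⟨e, u⟩, rfl⟩ := diskRay_surjective hn z
    rw [hΦ, Ψ_base, δ_eq]

open CategoryTheory Limits in
theorem exists_homotopic_mulMap_one_of_CWComplex [CompactlyGeneratedSpace X]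
    [PathConnectedSpace X] {Y : TopCat.{u}} (hY : TopCat.CWComplex Y) (f : C(Y, James x₀)) :
    ∃ (g : C(Y, James x₀)) (P : C(I × Y, James x₀)),
      (∀ y, P (0, y) = g y * f y) ∧ ∀ y, P (1, y) = 1 := by
  let p : TopCat.of (LeftInv x₀) ⟶ TopCat.of (James x₀) :=
    TopCat.ofHom ⟨fun q => q.1.1, by fun_prop⟩
  have rlp : ∀ n, HasLiftingProperty (TopCat.diskBoundaryInclusion.{u} n) p := fun n =>
    ⟨fun {ψ b} sq => by
      obtain ⟨Φ, hΦψ, hΦb⟩ := LeftInv.exists_extension_disk n ψ.hom b.hom fun u =>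
        (ConcreteCategory.congr_hom sq.w u).trans (congrArg b (diskRay_zero u).symm)
      refine ⟨⟨TopCat.ofHom Φ, ?_, TopCat.hom_ext (ContinuousMap.ext hΦb)⟩⟩
      exact TopCat.hom_ext (ContinuousMap.ext fun u =>
        (congrArg Φ (diskRay_zero u).symm).trans (hΦψ u))⟩
  have := hasLiftingProperty_of_relativeCWComplex hY p rlp
  have sq : CommSq (initial.to (TopCat.of (LeftInv x₀))) (initial.to Y) p (TopCat.ofHom f) :=
    ⟨initial.hom_ext _ _⟩
  let φ : C(Y, LeftInv x₀) := sq.lift.hom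
  have φ_base : ∀ y, (φ y).1.1 = f y := ConcreteCategory.congr_hom sq.fac_right
  have continuous_path : Continuous fun y => (φ y).1.2.2 := by fun_prop
  refine ⟨⟨fun y => (φ y).1.2.1, by fun_prop⟩, ⟨fun q => (φ q.2).1.2.2 q.1,
    (continuous_path.comp continuous_snd).eval continuous_fst⟩, fun y => ?_, fun y => (φ y).2.2⟩
  rw [← φ_base y]
  exact (φ y).2.1

end James

section LeftInverseOfE

open unitInterval

theorem NondegenerateBasepoint.exists_collapse {Z : Type u} [TopologicalSpace Z] {z₀ : Z}
    (hz₀ : NondegenerateBasepoint z₀) :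
    ∃ (κ : C(Z, ℝ)) (ρ : C(Z, Z)), κ z₀ = 1 ∧ (∀ z, 0 ≤ κ z → ρ z = z₀) ∧
      (ContinuousMap.id Z).HomotopicRel ρ {z₀} := by
  obtain ⟨v, h, hv, h0, hb, h1⟩ := hz₀
  refine ⟨⟨fun z => 1 - 2 * v z, by fun_prop⟩, ⟨fun z => h (1, z), by fun_prop⟩,
    by simp [(hv z₀).2 rfl], fun z hz => h1 z (Subtype.coe_lt_coe.1 ?_),
    homotopicRel_of_map h h.continuous h0 (fun _ => rfl) ?_⟩
  · have : (0 : ℝ) ≤ 1 - 2 * v z := hz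
    rw [Set.Icc.coe_one]
    linarith
  · rintro t z rfl
    exact hb t

theorem James.exists_pointed_mulMap_homotopicRel_one {X Z : Type u} [TopologicalSpace X] {x₀ : X}
    [TopologicalSpace Z] [CompactlyGeneratedSpace Z] {z₀ : Z} (hz₀ : NondegenerateBasepoint z₀)
    {f g : C(Z, James x₀)} (hf : f z₀ = 1)
    (hgf : (James.mulMap g f).Homotopic (ContinuousMap.const Z 1)) :
    ∃ g' : C(Z, James x₀), g' z₀ = 1 ∧
      (James.mulMap g' f).HomotopicRel (ContinuousMap.const Z 1) {z₀} := by
  obtain ⟨κ, ρ, κ_base, ρ_eq, id_ρ⟩ := hz₀.exists_collapse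
  obtain ⟨K⟩ := hgf
  have K_zero : ∀ z, K (0, z) = g z * f z := K.apply_zero
  have K_one : ∀ z, K (1, z) = 1 := K.apply_one
  have ρ_base : ρ z₀ = z₀ := ρ_eq z₀ (by simp [κ_base])
  let κ' : C(Z, I) := ⟨fun z => Set.projIcc 0 1 zero_le_one (κ z), by fun_prop⟩
  have κ'_zero : ∀ {z}, κ z ≤ 0 → κ' z = 0 := Set.projIcc_of_le_left zero_le_one
  have κ'_base : κ' z₀ = 1 := Set.projIcc_of_right_le zero_le_one κ_base.ge
  let g' : C(Z, James x₀) := ⟨fun z => if 0 ≤ κ z then K (κ' z, z₀) else g (ρ z), by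
    refine Continuous.if_le (by fun_prop) (by fun_prop) (by fun_prop) (by fun_prop) fun z hz => ?_
    rw [ρ_eq z hz.le, κ'_zero hz.ge, K_zero, hf, mul_one]⟩
  have g'_mul : ∀ z, g' z * f (ρ z) = K (κ' z, ρ z) := fun z => by
    by_cases hz : 0 ≤ κ z
    · simp [g', hz, ρ_eq z hz, hf]
    · rw [κ'_zero (not_le.1 hz).le, K_zero]
      simp [g', hz]
  have g'_base : g' z₀ = 1 := by simpa [ρ_base, κ'_base, hf] using g'_mul z₀
  have mulMap_ρ : (James.mulMap g' (f.comp ρ)).HomotopicRel (ContinuousMap.const Z 1) {z₀} := by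
    refine homotopicRel_of_map (fun p => K (max p.1 (κ' p.2), ρ p.2)) (by fun_prop) (fun z => ?_)
      (fun z => ?_) ?_
    · simp only [max_eq_right (nonneg' : 0 ≤ κ' z), ← g'_mul]
      rfl
    · simp only [max_eq_left (le_one' : κ' z ≤ 1), K_one, ContinuousMap.const_apply]
    · rintro t z rfl
      simp only [κ'_base, max_eq_right (le_one' : t ≤ 1), James.mulMap, g'_base,
        ρ_base, hf, ContinuousMap.coe_mk, ContinuousMap.comp_apply, mul_one]
      exact K_one z
  exact ⟨g', g'_base, (James.mulMap_homotopicRel (.refl g')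
    (by simpa using id_ρ.comp_continuousMap f)).trans mulMap_ρ⟩

variable {X : Type u} [TopologicalSpace X] [CompactlyGeneratedSpace X] [PathConnectedSpace X]
  {x₀ : X}

theorem James.exists_mulMap_homotopic_one_of_hasCWHomotopyType {Z : Type u} [TopologicalSpace Z]
    [CompactlyGeneratedSpace Z] (hCW : HasCWHomotopyType Z) (f : C(Z, James x₀)) :
    ∃ g : C(Z, James x₀), (James.mulMap g f).Homotopic (ContinuousMap.const Z 1) := by
  obtain ⟨Y, ⟨hY⟩, ⟨e⟩⟩ := hCW
  obtain ⟨g, P, P_zero, P_one⟩ :=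
    James.exists_homotopic_mulMap_one_of_CWComplex hY (f.comp e.invFun)
  have mulMap_comp : (James.mulMap (g.comp e.toFun) (f.comp (e.invFun.comp e.toFun))).HomotopicRel
      (ContinuousMap.const Z 1) ∅ :=
    homotopicRel_of_map (fun p => P (p.1, e.toFun p.2)) (by fun_prop) (fun z => P_zero _)
      (fun z => P_one _) fun _ _ h => h.elim
  refine ⟨g.comp e.toFun, ContinuousMap.homotopicRel_empty.1
    ((James.mulMap_homotopicRel (.refl _) ?_).trans mulMap_comp)⟩
  exact (ContinuousMap.homotopicRel_empty.2 e.left_inv).symm.comp_continuousMap f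

theorem James.exists_leftInverse_E (hx₀ : NondegenerateBasepoint x₀) (hCW : HasCWHomotopyType X) :
    ∃ g : C(X, James x₀), g x₀ = 1 ∧
      (James.mulMap g (James.E x₀)).HomotopicRel (ContinuousMap.const X 1) {x₀} :=
  have ⟨_, hg⟩ := James.exists_mulMap_homotopic_one_of_hasCWHomotopyType hCW (James.E x₀)
  James.exists_pointed_mulMap_homotopicRel_one hx₀ James.of_base hg

end LeftInverseOfE

section Inversion

open unitInterval MulOpposite

theorem continuous_homotopy_div {X Y : Type*} [TopologicalSpace X] [TopologicalSpace Y] {x₀ : X}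
    {y₀ : Y} {v : X → ℝ} (hv : Continuous v) (hv₀ : ∀ x, v x = 0 → x = x₀) {H : I × X → Y}
    (hH : Continuous H) (hH₀ : ∀ t, H (t, x₀) = y₀) :
    Continuous fun p : ℝ × X => H (Set.projIcc 0 1 zero_le_one (p.1 / v p.2), p.2) := by
  refine continuous_iff_continuousAt.2 fun ⟨s, x⟩ => ?_
  by_cases hx : v x = 0
  · -- Here `s / v` need not be continuous, but `H` is close to `y₀` on all of `I × {x}`.
    obtain rfl := hv₀ x hx
    rw [ContinuousAt, hH₀]
    intro U hU
    have tendsto_H : ∀ t, Filter.Tendsto (fun z : X × I => H (z.2, z.1)) (𝓝 (x, t)) (𝓝 y₀) :=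
      fun t => by
        have := (hH.comp continuous_swap).tendsto (x, t)
        rwa [Function.comp_apply, Prod.swap_prod_mk, hH₀] at this
    have eventually_H : ∀ᶠ y in 𝓝 x, ∀ t ∈ (Set.univ : Set I), H (t, y) ∈ U :=
      isCompact_univ.eventually_forall_of_forall_eventually fun t _ => tendsto_H t hU
    rw [nhds_prod_eq]
    exact (eventually_H.prod_inr (𝓝 s)).mono fun p hp => hp _ trivial
  · have continuousAt_div : ContinuousAt (fun p : ℝ × X => p.1 / v p.2) (s, x) :=
      continuousAt_fst.div (by fun_prop) hx
    exact hH.continuousAt.comp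
      ((continuous_projIcc.continuousAt.comp continuousAt_div).prodMk continuousAt_snd)

namespace James

variable {X : Type u} {x₀ : X}

theorem induction_on {p : James x₀ → Prop} (w : James x₀) (one : p 1)
    (of_mul : ∀ x w, p w → p (of x₀ x * w)) : p w := by
  obtain ⟨l, rfl⟩ := Con.mk'_surjective w
  induction l using FreeMonoid.inductionOn' with
  | one => exact one
  | of_mul x l ih =>
    rw [map_mul]
    exact of_mul x _ ih

variable [TopologicalSpace X]

variable (x₀) in
/-- A map `χ` that is a left inverse of the identity of `J(X)` up to a pointed homotopy `G`. -/
structure Inversion where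
  χ : C(James x₀, James x₀)
  G : C(I × James x₀, James x₀)
  χ_one : χ 1 = 1
  G_zero : ∀ w, G (0, w) = χ w * w
  G_one : ∀ w, G (1, w) = 1
  G_base : ∀ t, G (t, 1) = 1

variable (x₀) in
/-- A left inverse `g` of `E : X → J(X)` up to homotopy, with the homotopy from `g x * x` to `1`
reparametrised as a path `s ↦ k (s, x)` that rests until time `0` and ends at time `v x`. -/
structure LetterInversion where
  v : C(X, ℝ)
  g : C(X, James x₀)
  k : C(ℝ × X, James x₀)
  v_nonneg : ∀ x, 0 ≤ v x
  v_base : v x₀ = 0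
  k_of_nonpos : ∀ x s, s ≤ 0 → k (s, x) = g x * of x₀ x
  k_of_le : ∀ x s, v x ≤ s → k (s, x) = 1

theorem nonempty_letterInversion [CompactlyGeneratedSpace X] [PathConnectedSpace X]
    (hx₀ : NondegenerateBasepoint x₀) (hCW : HasCWHomotopyType X) :
    Nonempty (LetterInversion x₀) := by
  obtain ⟨g, g_base, ⟨H⟩⟩ := exists_leftInverse_E hx₀ hCW
  obtain ⟨u, -, u_eq_zero, -⟩ := hx₀
  have H_base : ∀ t, H (t, x₀) = 1 := fun t => (H.eq_fst t rfl).trans (by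
    simp [mulMap, g_base, show E x₀ x₀ = 1 from of_base])
  refine ⟨⟨fun x => u x, by fun_prop⟩, g, ⟨_, continuous_homotopy_div (v := fun x => (u x : ℝ))
    (by fun_prop) (fun x hx => (u_eq_zero x).1 (Subtype.ext hx)) H.continuous H_base⟩,
    fun x => (u x).2.1, by simp [(u_eq_zero x₀).2 rfl], fun x s hs => ?_, fun x s hs => ?_⟩
  · have : s / u x ≤ 0 := div_nonpos_of_nonpos_of_nonneg hs (u x).2.1
    rw [ContinuousMap.coe_mk, Set.projIcc_of_le_left _ this]
    exact H.apply_zero x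
  · rcases (u x).2.1.eq_or_lt with hx | hx
    · rw [(u_eq_zero x).1 (Subtype.ext hx.symm)]
      exact H_base _
    · rw [ContinuousMap.coe_mk, Set.projIcc_of_right_le _ ((one_le_div hx).2 hs)]
      exact H.apply_one x

namespace LetterInversion

variable (D : LetterInversion x₀)

theorem g_base : D.g x₀ = 1 := by
  simpa [of_base, D.k_of_le x₀ 0 D.v_base.le] using (D.k_of_nonpos x₀ 0 le_rfl).symm

theorem k_base (s : ℝ) : D.k (s, x₀) = 1 := by
  rcases le_total s 0 with hs | hs
  · rw [D.k_of_nonpos x₀ s hs, D.g_base, of_base, mul_one]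
  · exact D.k_of_le x₀ s (D.v_base.trans_le hs)

/-- The transformation of `J(X) × ℝ` by a letter `x`: at non-positive times multiply on the left by
`g x` and on the right by `x`, at positive times `s` multiply by `k (s, x)`; then subtract `v x`
from the time. -/
noncomputable def letterAct (x : X) : Function.End (James x₀ × ℝ) :=
  fun ρ => (if ρ.2 ≤ 0 then D.g x * ρ.1 * of x₀ x else ρ.1 * D.k (ρ.2, x), ρ.2 - D.v x)

/-- The action of words on `J(X) × ℝ`, the first letter acting first. -/
noncomputable def wordAct : James x₀ →* (Function.End (James x₀ × ℝ))ᵐᵒᵖ :=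
  lift (fun x => op (D.letterAct x)) (by
    refine MulOpposite.unop_injective (funext fun ρ => ?_)
    simp [letterAct, D.v_base, D.g_base, D.k_base, of_base, Function.End.one_def])

/-- The sum of the lengths `v x` of the letters `x` of a word. -/
noncomputable def wordLength : James x₀ →* Multiplicative ℝ :=
  lift (fun x => Multiplicative.ofAdd (D.v x)) (by simp [D.v_base])

/-- The antihomomorphism `J(X) → J(X)` extending `g`. -/
noncomputable def antiLift : James x₀ →* (James x₀)ᵐᵒᵖ :=
  lift (fun x => op (D.g x)) (by simp [D.g_base])

theorem wordAct_of_mul (x : X) (w : James x₀) (ρ : James x₀ × ℝ) :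
    (D.wordAct (of x₀ x * w)).unop ρ = (D.wordAct w).unop (D.letterAct x ρ) := by
  rw [map_mul, unop_mul, wordAct, lift_of]
  rfl

theorem wordLength_of_mul (x : X) (w : James x₀) :
    (D.wordLength (of x₀ x * w)).toAdd = D.v x + (D.wordLength w).toAdd := by
  rw [map_mul, toAdd_mul, wordLength, lift_of, toAdd_ofAdd]

theorem wordAct_snd (w : James x₀) (ρ : James x₀ × ℝ) :
    ((D.wordAct w).unop ρ).2 = ρ.2 - (D.wordLength w).toAdd := by
  induction w using induction_on generalizing ρ with
  | one => simp [Function.End.one_def]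
  | of_mul x w ih =>
    rw [wordAct_of_mul, ih, wordLength_of_mul, letterAct]
    ring

theorem wordAct_fst_of_nonpos (w : James x₀) (ρ : James x₀ × ℝ) (hρ : ρ.2 ≤ 0) :
    ((D.wordAct w).unop ρ).1 = (D.antiLift w).unop * ρ.1 * w := by
  induction w using induction_on generalizing ρ with
  | one => simp [Function.End.one_def]
  | of_mul x w ih =>
    rw [wordAct_of_mul, ih _ (by simpa [letterAct] using hρ.trans (D.v_nonneg x)), map_mul,
      unop_mul, antiLift, lift_of]
    simp [letterAct, hρ, mul_assoc]

theorem letterAct_fst_eq_one (x : X) (ρ : James x₀ × ℝ) (hρ : 0 ≤ ρ.2 → ρ.1 = 1)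
    (h : 0 ≤ (D.letterAct x ρ).2) : (D.letterAct x ρ).1 = 1 := by
  have v_le : D.v x ≤ ρ.2 := sub_nonneg.1 h
  simp only [letterAct, hρ ((D.v_nonneg x).trans v_le), mul_one, one_mul]
  split_ifs with hs
  · rw [← D.k_of_nonpos x ρ.2 hs, D.k_of_le x ρ.2 v_le]
  · exact D.k_of_le x ρ.2 v_le

theorem wordAct_fst_eq_one (w : James x₀) (ρ : James x₀ × ℝ) (hρ : 0 ≤ ρ.2 → ρ.1 = 1)
    (h : 0 ≤ ((D.wordAct w).unop ρ).2) : ((D.wordAct w).unop ρ).1 = 1 := by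
  induction w using induction_on generalizing ρ with
  | one => exact hρ h
  | of_mul x w ih =>
    rw [wordAct_of_mul] at h ⊢
    exact ih _ (D.letterAct_fst_eq_one x ρ hρ) h

/-- The homotopy from `antiLift w * w` to `1`, in which `w` acts on `1` starting from time
`t * wordLength w`. -/
noncomputable def contraction (t : I) (w : James x₀) : James x₀ :=
  ((D.wordAct w).unop (1, t * (D.wordLength w).toAdd)).1

theorem contraction_zero (w : James x₀) : D.contraction 0 w = (D.antiLift w).unop * w := by
  rw [contraction, D.wordAct_fst_of_nonpos _ _ (by simp), mul_one]

theorem contraction_one (w : James x₀) : D.contraction 1 w = 1 :=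
  D.wordAct_fst_eq_one _ _ (fun _ => rfl) (by simp [wordAct_snd])

theorem continuous_wordLength : Continuous fun w : James x₀ => (D.wordLength w).toAdd := by
  refine continuous_of_comp_word fun l => ?_
  simp only [wordLength, lift_word, List.prod_ofFn, toAdd_prod, toAdd_ofAdd]
  exact continuous_finsetSum _ fun i _ => D.v.continuous.comp (CGPow.continuous_apply i)

theorem continuous_antiLift : Continuous fun w : James x₀ => (D.antiLift w).unop := by
  refine continuous_of_comp_word fun l => ?_
  simp only [antiLift, lift_word]
  exact continuous_unop_list_prod fun i => D.g.continuous.comp (CGPow.continuous_apply i)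

variable [CompactlyGeneratedSpace X]

-- The two branches of `letterAct` only agree at time `0` where the first component is `1`.
theorem continuous_letterAct {Z : Type u} [TopologicalSpace Z] [CompactlyGeneratedSpace Z]
    {b : Z → X} (hb : Continuous b) {ρ : Z → James x₀ × ℝ} (hρ : Continuous ρ)
    (hρ₁ : ∀ z, 0 ≤ (ρ z).2 → (ρ z).1 = 1) : Continuous fun z => D.letterAct (b z) (ρ z) := by
  have continuous_of : Continuous fun z => of x₀ (b z) := (E x₀).continuous.comp hb
  refine Continuous.prodMk (Continuous.if_le ?_ ?_ (by fun_prop) continuous_const fun z hz => ?_)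
    (by fun_prop)
  · exact continuous_mul (continuous_mul (by fun_prop) (by fun_prop)) continuous_of
  · exact continuous_mul (by fun_prop) (by fun_prop)
  · rw [hρ₁ z hz.ge, one_mul, mul_one, hz, D.k_of_nonpos _ _ le_rfl]

theorem continuous_wordAct_word {Z : Type u} [TopologicalSpace Z] [CompactlyGeneratedSpace Z]
    (l : ℕ) {b : Z → CGPow X l} (hb : ∀ i, Continuous fun z => b z i) {ρ : Z → James x₀ × ℝ}
    (hρ : Continuous ρ) (hρ₁ : ∀ z, 0 ≤ (ρ z).2 → (ρ z).1 = 1) :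
    Continuous fun z => (D.wordAct (word x₀ ⟨l, b z⟩)).unop (ρ z) := by
  induction l generalizing ρ with
  | zero => simpa [word, Function.End.one_def] using hρ
  | succ l ih =>
    have word_succ : ∀ z, word x₀ ⟨l + 1, b z⟩ =
        of x₀ (b z 0) * word x₀ ⟨l, (fun i : Fin l => b z i.succ : CGPow X l)⟩ := fun z => by
      simp [word, List.ofFn_succ]
    simp only [word_succ, wordAct_of_mul]
    exact ih (fun i => hb i.succ) (D.continuous_letterAct (hb 0) hρ hρ₁)
      fun z => D.letterAct_fst_eq_one _ _ (hρ₁ z)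

theorem continuous_contraction_word {Z : Type u} [TopologicalSpace Z] [CompactlyGeneratedSpace Z]
    {t : Z → I} (ht : Continuous t) {l : ℕ} {b : Z → CGPow X l} (hb : Continuous b) :
    Continuous fun z => D.contraction (t z) (word x₀ ⟨l, b z⟩) := by
  have continuous_length : Continuous fun z => (D.wordLength (word x₀ ⟨l, b z⟩)).toAdd :=
    D.continuous_wordLength.comp (continuous_word.comp (continuous_sigmaMk.comp hb))
  exact continuous_fst.comp (D.continuous_wordAct_word l
    (fun i => (CGPow.continuous_apply i).comp hb) (by fun_prop) fun _ _ => rfl)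

theorem continuous_contraction :
    Continuous fun p : I × James x₀ => D.contraction p.1 p.2 := by
  have compactlyGenerated (K : Type u) [TopologicalSpace K] [CompactSpace K] [T2Space K] :
      CompactlyGeneratedSpace K := inferInstance
  have continuous_swapped :=
    continuous_uncurry (CompHaus.of (ULift.{u} I)) (fun t w => D.contraction t.down w)
      fun l S b =>
        have := compactlyGenerated (S × ULift.{u} I)
        D.continuous_contraction_word (continuous_uliftDown.comp continuous_snd)
          (b.continuous.comp continuous_fst)
  exact continuous_swapped.comp (f := fun p : I × James x₀ => (p.2, ULift.up p.1)) (by fun_prop)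

/-- The inversion of `J(X)` that inverts words letter by letter. -/
noncomputable def toInversion : Inversion x₀ where
  χ := ⟨_, D.continuous_antiLift⟩
  G := ⟨_, D.continuous_contraction⟩
  χ_one := by simp
  G_zero := D.contraction_zero
  G_one := D.contraction_one
  G_base t := by simp [contraction, Function.End.one_def]

end LetterInversion

end James

end Inversion

section Killing

open unitInterval

variable {X : Type u} [TopologicalSpace X]

namespace James.Inversion

variable {x₀ : X} (D : James.Inversion x₀) {Z : Type u} [TopologicalSpace Z]
  [CompactlyGeneratedSpace Z]

/-- The map `χ(g) f`, modified by a canonical homotopy where `u ≤ 1 / 2` and `f = g` so as to be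
trivial where `u ≤ 0`. -/
noncomputable def kill (f g : C(Z, James x₀)) (u : C(Z, ℝ)) (h : ∀ z, u z ≤ 1 / 2 → f z = g z) :
    C(Z, James x₀) where
  toFun z := if u z ≤ 1 / 2 then D.G (Set.projIcc 0 1 zero_le_one (1 - 2 * u z), f z) else
    D.χ (g z) * f z
  continuous_toFun := by
    refine Continuous.if_le (by fun_prop) (continuous_mul (by fun_prop) (by fun_prop)) (by fun_prop)
      continuous_const fun z hz => ?_
    rw [Set.projIcc_of_le_left _ (by rw [hz]; norm_num), ← h z hz.le]
    exact D.G_zero _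

variable {f g : C(Z, James x₀)} {u : C(Z, ℝ)} (h : ∀ z, u z ≤ 1 / 2 → f z = g z)

theorem kill_apply (z : Z) : D.kill f g u h z =
    if u z ≤ 1 / 2 then D.G (Set.projIcc 0 1 zero_le_one (1 - 2 * u z), f z) else
      D.χ (g z) * f z := rfl

theorem kill_of_nonpos {z : Z} (hz : u z ≤ 0) : D.kill f g u h z = 1 := by
  rw [kill_apply, if_pos (by linarith), Set.projIcc_of_right_le _ (by linarith)]
  exact D.G_one _

theorem kill_of_eq_one {z : Z} (hf : f z = 1) (hg : g z = 1) : D.kill f g u h z = 1 := by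
  rw [kill_apply, hf, hg, D.G_base, D.χ_one, mul_one, ite_self]

theorem kill_homotopicRel :
    (D.kill f g u h).HomotopicRel (mulMap (D.χ.comp g) f) {z | f z = 1 ∧ g z = 1} := by
  refine homotopicRel_of_map (fun p => if u p.2 ≤ 1 / 2 then
    D.G (σ p.1 * Set.projIcc 0 1 zero_le_one (1 - 2 * u p.2), f p.2) else
      D.χ (g p.2) * f p.2) ?_ (fun z => ?_) (fun z => ?_) fun t z ⟨hf, hg⟩ => ?_
  · refine Continuous.if_le (by fun_prop) (continuous_mul (by fun_prop) (by fun_prop)) (by fun_prop)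
      continuous_const fun p hp => ?_
    rw [Set.projIcc_of_le_left _ (by rw [hp]; norm_num), ← h p.2 hp.le]
    exact (congrArg (fun s => D.G (s, f p.2)) (mul_zero _)).trans (D.G_zero _)
  · simp [kill_apply]
  · simp only [symm_one, zero_mul]
    split_ifs with hz
    · rw [D.G_zero, h z hz]
      simp [mulMap, h z hz]
    · rfl
  · rw [D.kill_of_eq_one h hf hg]
    simp only [hf, hg, D.G_base, D.χ_one, mul_one, ite_self]

theorem kill_homotopicRel_of_null {f' : C(Z, James x₀)} {S : Set Z}
    (hg : g.HomotopicRel (ContinuousMap.const Z 1) S) (hf : f.HomotopicRel f' S)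
    (hfS : ∀ z ∈ S, f z = 1) : (D.kill f g u h).HomotopicRel f' S := by
  have χ_null : (D.χ.comp g).HomotopicRel (ContinuousMap.const Z 1) S := by
    have χ_const : D.χ.comp (ContinuousMap.const Z 1) = ContinuousMap.const Z 1 :=
      ContinuousMap.ext fun _ => D.χ_one
    exact χ_const ▸ hg.comp_continuousMap D.χ
  have one_mulMap : mulMap (ContinuousMap.const Z 1) f' = f' :=
    ContinuousMap.ext fun _ => one_mul _
  have mul_homotopic := mulMap_homotopicRel χ_null hf
  rw [one_mulMap] at mul_homotopic
  exact (homotopicRel_mono (D.kill_homotopicRel h) fun z hz =>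
    ⟨hfS z hz, hg.fst_eq_snd hz⟩).trans mul_homotopic

theorem χ_mul_homotopicRel (f : C(Z, James x₀)) :
    (mulMap (D.χ.comp f) f).HomotopicRel (ContinuousMap.const Z 1) {z | f z = 1} := by
  refine homotopicRel_of_map (fun p => D.G (p.1, f p.2)) (by fun_prop) (fun z => D.G_zero _)
    (fun z => D.G_one _) fun t z (hz : f z = 1) => ?_
  simp [mulMap, hz, D.G_base, D.χ_one]

include D in
theorem exists_mul_eq_one {z₀ : Z} (a : HoClass z₀ (1 : James x₀)) : ∃ b, b * a = 1 := by
  obtain ⟨f, hf⟩ := a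
  refine ⟨HoClass.mk (D.χ.comp f) (by simp [hf, D.χ_one]), Quotient.sound ?_⟩
  exact homotopicRel_mono (D.χ_mul_homotopicRel f) (by simpa using hf)

include D in
theorem isUnit {z₀ : Z} (a : HoClass z₀ (1 : James x₀)) : IsUnit a := by
  obtain ⟨b, hb⟩ := D.exists_mul_eq_one a
  obtain ⟨c, hc⟩ := D.exists_mul_eq_one b
  have c_eq : c = a := left_inv_eq_right_inv hc hb
  exact ⟨⟨a, b, c_eq ▸ hc, hb⟩, rfl⟩

end James.Inversion

end Killing

section FatWedge

open unitInterval

variable {X : Type u} [TopologicalSpace X] {x₀ : X} {k : ℕ}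

namespace CGPow

/-- The map to a power with given coordinates. -/
def mkMap {Z : Type u} [TopologicalSpace Z] [CompactlyGeneratedSpace Z]
    (f : Fin k → C(Z, X)) : C(Z, CGPow X k) :=
  ⟨fun z i => f i z, continuous_of_apply _ fun i => (f i).continuous⟩

theorem mkMap_apply {Z : Type u} [TopologicalSpace Z] [CompactlyGeneratedSpace Z]
    (f : Fin k → C(Z, X)) (z : Z) (i : Fin k) : mkMap f z i = f i z := rfl

/-- The coordinate projections of a power. -/
def coord (i : Fin k) : C(CGPow X k, X) := ⟨fun x => x i, continuous_apply i⟩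

variable (x₀) in
/-- The map of a power to itself that replaces a coordinate by the base point. -/
def erase (j : Fin k) : C(CGPow X k, CGPow X k) :=
  mkMap fun i => if i = j then ContinuousMap.const _ x₀ else coord i

theorem erase_apply (j i : Fin k) (x : CGPow X k) :
    erase x₀ j x i = if i = j then x₀ else x i := by
  rw [erase, mkMap_apply]
  split_ifs <;> rfl

theorem erase_eq_self {j : Fin k} {x : CGPow X k} (hx : x j = x₀) : erase x₀ j x = x :=
  funext fun i => by
    rw [erase_apply]
    split_ifs with h
    · rw [h, hx]
    · rfl

theorem erase_base (j : Fin k) : erase x₀ j (base x₀ k) = base x₀ k := erase_eq_self rfl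

end CGPow

section Wedges

variable {X : Type u} {x₀ : X} {k : ℕ}

variable (x₀) in
/-- The tuples with a trivial coordinate among those indexed by `s`. -/
def partialWedge (s : Finset (Fin k)) : Set (CGPow X k) := {x | ∃ i ∈ s, x i = x₀}

variable (x₀ k) in
/-- The fat wedge: the tuples with a trivial coordinate. -/
def fatWedge : Set (CGPow X k) := {x | ∃ i, x i = x₀}

theorem partialWedge_empty : partialWedge x₀ (∅ : Finset (Fin k)) = ∅ := by
  simp [partialWedge]

theorem partialWedge_univ : partialWedge x₀ (Finset.univ : Finset (Fin k)) = fatWedge x₀ k := by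
  simp [partialWedge, fatWedge]

theorem partialWedge_subset_fatWedge (s : Finset (Fin k)) : partialWedge x₀ s ⊆ fatWedge x₀ k :=
  fun _ ⟨i, _, hx⟩ => ⟨i, hx⟩

theorem mem_partialWedge_insert {s : Finset (Fin k)} {i : Fin k} {x : CGPow X k} :
    x ∈ partialWedge x₀ (insert i s) ↔ x i = x₀ ∨ x ∈ partialWedge x₀ s := by
  simp [partialWedge]

end Wedges

variable (x₀) in
/-- The data of a nondegenerate base point: a deformation `h` of `X` that moves the neighbourhood
`v < 1` of the base point into it. -/
structure NDRData where
  v : C(X, I)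
  h : C(I × X, X)
  v_base : v x₀ = 0
  h_zero : ∀ x, h (0, x) = x
  h_base : ∀ t, h (t, x₀) = x₀
  h_one : ∀ x, v x < 1 → h (1, x) = x₀

namespace NDRData

variable (N : NDRData x₀)

/-- The coordinatewise deformation of a power of `X`. -/
def pow (k : ℕ) : C(I × CGPow X k, CGPow X k) :=
  CGPow.mkMap fun i => N.h.comp ⟨fun p => (p.1, CGPow.coord i p.2), by fun_prop⟩

/-- The end of the deformation `NDRData.pow`. -/
def powOne (k : ℕ) : C(CGPow X k, CGPow X k) :=
  (N.pow k).comp ⟨fun x => (1, x), by fun_prop⟩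

theorem pow_zero (x : CGPow X k) : N.pow k (0, x) = x :=
  funext fun i => N.h_zero (x i)

theorem pow_of_base (t : I) {x : CGPow X k} {i : Fin k} (hx : x i = x₀) :
    N.pow k (t, x) i = x₀ :=
  (congrArg (fun y => N.h (t, y)) hx).trans (N.h_base t)

theorem pow_base (t : I) : N.pow k (t, CGPow.base x₀ k) = CGPow.base x₀ k :=
  funext fun _ => N.pow_of_base t rfl

theorem powOne_of_base {x : CGPow X k} {i : Fin k} (hx : x i = x₀) : N.powOne k x i = x₀ :=
  N.pow_of_base 1 hx

theorem powOne_base : N.powOne k (CGPow.base x₀ k) = CGPow.base x₀ k := N.pow_base 1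

theorem homotopicRel_comp_powOne {Y : Type*} [TopologicalSpace Y] (f : C(CGPow X k, Y))
    {S : Set (CGPow X k)} (hS : ∀ t, ∀ x ∈ S, f (N.pow k (t, x)) = f x) :
    f.HomotopicRel (f.comp (N.powOne k)) S :=
  homotopicRel_of_map (fun p => f (N.pow k p)) (by fun_prop) (fun x => congrArg f (N.pow_zero x))
    (fun _ => rfl) hS

theorem powOne_mem_partialWedge {s : Finset (Fin k)} {x : CGPow X k}
    (hx : x ∈ partialWedge x₀ s) : N.powOne k x ∈ partialWedge x₀ s :=
  have ⟨i, hi, hx⟩ := hx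
  ⟨i, hi, N.powOne_of_base hx⟩

/-- The height `v (x j)` of a point `x` over the face where the `j`-th coordinate is trivial. -/
def height (j : Fin k) : C(CGPow X k, ℝ) :=
  ContinuousMap.comp ⟨fun t : I => (t : ℝ), continuous_subtype_val⟩ (N.v.comp (CGPow.coord j))

theorem height_of_base {j : Fin k} {x : CGPow X k} (hx : x j = x₀) : N.height j x = 0 := by
  change ((N.v (x j) : I) : ℝ) = 0
  rw [hx, N.v_base, Set.Icc.coe_zero]

theorem powOne_of_height_le {j : Fin k} {x : CGPow X k} (hx : N.height j x ≤ 1 / 2) :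
    N.powOne k x j = x₀ :=
  N.h_one _ (Subtype.coe_lt_coe.1 (hx.trans_lt (by norm_num)))

variable (D : James.Inversion x₀) (j : Fin k) {Φ Ψ : C(CGPow X k, James x₀)}

/-- The map `Φ`, divided by its restriction to the face where the `j`-th coordinate is trivial and
modified near that face so as to be trivial on it. -/
noncomputable def killFace (Φ : C(CGPow X k, James x₀)) : C(CGPow X k, James x₀) :=
  D.kill (Φ.comp (N.powOne k)) ((Φ.comp (CGPow.erase x₀ j)).comp (N.powOne k)) (N.height j)
    fun x hx => by simp [CGPow.erase_eq_self (N.powOne_of_height_le hx)]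

theorem killFace_of_base {x : CGPow X k} (hx : x j = x₀) : N.killFace D j Φ x = 1 :=
  D.kill_of_nonpos _ (N.height_of_base hx).le

theorem erase_powOne_mem_partialWedge {s : Finset (Fin k)} {x : CGPow X k}
    (hx : x ∈ partialWedge x₀ s) : CGPow.erase x₀ j (N.powOne k x) ∈ partialWedge x₀ s :=
  have ⟨i, hi, hx⟩ := hx
  ⟨i, hi, by rw [CGPow.erase_apply, N.powOne_of_base hx, ite_self]⟩

theorem killFace_eq_one {s : Finset (Fin k)} (hΦ : ∀ x ∈ partialWedge x₀ s, Φ x = 1)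
    {x : CGPow X k} (hx : x ∈ partialWedge x₀ (insert j s)) : N.killFace D j Φ x = 1 := by
  rcases mem_partialWedge_insert.1 hx with hx | hx
  · exact N.killFace_of_base D j hx
  · exact D.kill_of_eq_one _ (hΦ _ (N.powOne_mem_partialWedge hx))
      (hΦ _ (N.erase_powOne_mem_partialWedge j hx))

theorem killFace_const_one : N.killFace D j (ContinuousMap.const _ 1) = ContinuousMap.const _ 1 :=
  ContinuousMap.ext fun _ => D.kill_of_eq_one _ rfl rfl

theorem continuous_killFace_curry (K : C(I × CGPow X k, James x₀)) :
    Continuous fun p : I × CGPow X k => N.killFace D j (K.curry p.1) p.2 :=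
  (D.kill (K.comp ⟨fun p => (p.1, N.powOne k p.2), by fun_prop⟩)
    (K.comp ⟨fun p => (p.1, CGPow.erase x₀ j (N.powOne k p.2)), by fun_prop⟩)
    ((N.height j).comp ContinuousMap.snd) fun p hp => congrArg (fun x => K (p.1, x))
      (CGPow.erase_eq_self (N.powOne_of_height_le hp)).symm).continuous

theorem killFace_homotopicRel_killFace {s : Finset (Fin k)}
    (hΦ : ∀ x ∈ partialWedge x₀ s, Φ x = 1) (h : Φ.HomotopicRel Ψ (partialWedge x₀ s)) :
    (N.killFace D j Φ).HomotopicRel (N.killFace D j Ψ) (partialWedge x₀ (insert j s)) := by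
  obtain ⟨K⟩ := h
  have K_eq_one : ∀ t, ∀ x ∈ partialWedge x₀ s, K.toContinuousMap.curry t x = 1 :=
    fun t x hx => (K.eq_fst t hx).trans (hΦ x hx)
  have K_zero : K.toContinuousMap.curry 0 = Φ := ContinuousMap.ext K.apply_zero
  have K_one : K.toContinuousMap.curry 1 = Ψ := ContinuousMap.ext K.apply_one
  refine homotopicRel_of_map _ (N.continuous_killFace_curry D j K.toContinuousMap)
    (fun x => by rw [K_zero]) (fun x => by rw [K_one]) fun t x hx => ?_
  rw [N.killFace_eq_one D j (K_eq_one t) hx, N.killFace_eq_one D j hΦ hx]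

theorem killFace_homotopicRel_base (hΦ : Φ (CGPow.base x₀ k) = 1)
    (h : (Φ.comp (CGPow.erase x₀ j)).HomotopicRel (ContinuousMap.const _ 1)
      {CGPow.base x₀ k}) :
    (N.killFace D j Φ).HomotopicRel Φ {CGPow.base x₀ k} :=
  D.kill_homotopicRel_of_null _ (homotopicRel_comp_right h (N.powOne k) (by simp [N.powOne_base]))
    (N.homotopicRel_comp_powOne Φ (by simp [N.pow_base])).symm (by simp [N.powOne_base, hΦ])

theorem killFace_homotopicRel_fatWedge (hΦ : ∀ x ∈ fatWedge x₀ k, Φ x = 1) :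
    (N.killFace D j Φ).HomotopicRel Φ (fatWedge x₀ k) := by
  have face_eq : (Φ.comp (CGPow.erase x₀ j)).comp (N.powOne k) = ContinuousMap.const _ 1 :=
    ContinuousMap.ext fun x => hΦ _ ⟨j, by simp [CGPow.erase_apply]⟩
  have pow_trivial (t : I) : ∀ x ∈ fatWedge x₀ k, Φ (N.pow k (t, x)) = 1 := fun x hx =>
    hΦ _ (hx.imp fun _ => N.pow_of_base t)
  refine D.kill_homotopicRel_of_null _ (by rw [face_eq]; exact .refl _)
    (N.homotopicRel_comp_powOne Φ fun t x hx => ?_).symm (pow_trivial 1)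
  rw [pow_trivial t x hx, hΦ x hx]

include N D

theorem exists_eq_one_on_fatWedge {f : C(CGPow X k, James x₀)} (hf : f (CGPow.base x₀ k) = 1)
    (h : ∀ j, (f.comp (CGPow.erase x₀ j)).HomotopicRel (ContinuousMap.const _ 1)
      {CGPow.base x₀ k}) :
    ∃ Φ : C(CGPow X k, James x₀), (∀ x ∈ fatWedge x₀ k, Φ x = 1) ∧
      Φ.HomotopicRel f {CGPow.base x₀ k} := by
  rw [← partialWedge_univ]
  induction (Finset.univ : Finset (Fin k)) using Finset.induction_on with
  | empty => exact ⟨f, by simp [partialWedge_empty], .refl _⟩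
  | insert j s _ ih =>
    obtain ⟨Φ, hΦ, hΦf⟩ := ih
    have face_null : (Φ.comp (CGPow.erase x₀ j)).HomotopicRel (ContinuousMap.const _ 1)
        {CGPow.base x₀ k} :=
      (homotopicRel_comp_right hΦf _ (by simp [CGPow.erase_base])).trans (h j)
    exact ⟨N.killFace D j Φ, fun x => N.killFace_eq_one D j hΦ,
      (N.killFace_homotopicRel_base D j ((hΦf.fst_eq_snd rfl).trans hf) face_null).trans hΦf⟩

theorem homotopicRel_fatWedge_of_homotopic (hΦ : ∀ x ∈ fatWedge x₀ k, Φ x = 1)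
    (h : Φ.Homotopic (ContinuousMap.const _ 1)) :
    Φ.HomotopicRel (ContinuousMap.const _ 1) (fatWedge x₀ k) := by
  rw [← partialWedge_univ]
  induction (Finset.univ : Finset (Fin k)) using Finset.induction_on with
  | empty => simpa [partialWedge_empty] using h
  | insert j s _ ih =>
    have killFace_null := N.killFace_homotopicRel_killFace D j
      (fun x hx => hΦ x (partialWedge_subset_fatWedge s hx)) ih
    rw [killFace_const_one] at killFace_null
    exact (homotopicRel_mono (N.killFace_homotopicRel_fatWedge D j hΦ).symm
      (partialWedge_subset_fatWedge _)).trans killFace_null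

end NDRData

end FatWedge

section JamesHopf

open unitInterval

section Words

variable {X : Type u} {M : Type*} [Monoid M]

/-- The combinatorial James–Hopf construction: the product of the values of `Φ` on all subwords of
length `k` of a word of length `n`, in a fixed order. -/
def hop : (k n : ℕ) → ((Fin k → X) → M) → (Fin n → X) → M
  | 0, _, Φ, _ => Φ Fin.elim0
  | _ + 1, 0, _, _ => 1
  | k + 1, n + 1, Φ, y =>
    hop (k + 1) n Φ (Fin.tail y) * hop k n (fun a => Φ (Fin.cons (y 0) a)) (Fin.tail y)

theorem hop_cons {k n : ℕ} (Φ : (Fin (k + 1) → X) → M) (x : X) (y : Fin n → X) :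
    hop (k + 1) (n + 1) Φ (Fin.cons x y) =
      hop (k + 1) n Φ y * hop k n (fun a => Φ (Fin.cons x a)) y := rfl

theorem hop_one (k n : ℕ) (y : Fin n → X) : hop k n (fun _ => (1 : M)) y = 1 := by
  induction n generalizing k with
  | zero => cases k <;> rfl
  | succ n ih =>
    cases k with
    | zero => rfl
    | succ k => rw [hop, ih, ih, one_mul]

theorem hop_of_lt {k n : ℕ} (Φ : (Fin k → X) → M) (y : Fin n → X) (h : n < k) :
    hop k n Φ y = 1 := by
  obtain ⟨k, rfl⟩ := Nat.exists_eq_add_one_of_ne_zero h.ne_bot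
  induction n generalizing k with
  | zero => rfl
  | succ n ih =>
    obtain ⟨k, rfl⟩ := Nat.exists_eq_add_one_of_ne_zero (Nat.lt_of_succ_lt_succ h).ne_bot
    rw [hop, ih _ _ _ (by omega), ih _ _ _ (by omega), one_mul]

theorem hop_self {k : ℕ} (Φ : (Fin k → X) → M) (y : Fin k → X) : hop k k Φ y = Φ y := by
  induction k with
  | zero => exact congrArg Φ (Subsingleton.elim _ _)
  | succ k ih =>
    rw [hop, hop_of_lt _ _ k.lt_succ_self, one_mul, ih]
    exact congrArg Φ (Fin.cons_self_tail y)

variable {x₀ : X}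

theorem hop_cons_base {k n : ℕ} {Φ : (Fin k → X) → M} (hΦ : ∀ a, (∃ i, a i = x₀) → Φ a = 1)
    (y : Fin n → X) : hop k (n + 1) Φ (Fin.cons x₀ y) = hop k n Φ y := by
  cases k with
  | zero => rw [hop, hop]
  | succ k =>
    have face_trivial : (fun a : Fin k → X => Φ (Fin.cons x₀ a)) = fun _ => 1 :=
      funext fun _ => hΦ _ ⟨0, rfl⟩
    rw [hop_cons, face_trivial, hop_one, mul_one]

theorem hop_insertNth {k n : ℕ} {Φ : (Fin k → X) → M} (hΦ : ∀ a, (∃ i, a i = x₀) → Φ a = 1)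
    (j : Fin (n + 1)) (y : Fin n → X) :
    hop k (n + 1) Φ (j.insertNth (α := fun _ => X) x₀ y) = hop k n Φ y := by
  induction n generalizing k with
  | zero =>
    obtain rfl : j = 0 := Fin.ext (by omega)
    rw [Fin.insertNth_zero', hop_cons_base hΦ]
  | succ n ih =>
    induction j using Fin.cases with
    | zero => rw [Fin.insertNth_zero', hop_cons_base hΦ]
    | succ j =>
      induction y using Fin.consCases with | cons x y => ?_
      rw [Fin.insertNth_succ_cons]
      cases k with
      | zero => rw [hop, hop]
      | succ k =>
        have face_trivial : ∀ a : Fin k → X, (∃ i, a i = x₀) → Φ (Fin.cons x a) = 1 :=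
          fun a ⟨i, hi⟩ => hΦ _ ⟨i.succ, hi⟩
        rw [hop_cons, hop_cons, ih hΦ, ih face_trivial]

theorem hop_base {k : ℕ} (hk : k ≠ 0) (n : ℕ) {Φ : (Fin k → X) → M}
    (hΦ : ∀ a, (∃ i, a i = x₀) → Φ a = 1) : hop k n Φ (fun _ => x₀) = 1 := by
  induction n with
  | zero => exact hop_of_lt _ _ hk.pos
  | succ n ih =>
    have base_eq_cons : (fun _ : Fin (n + 1) => x₀) = Fin.cons x₀ fun _ => x₀ :=
      (Fin.cons_self_tail _).symm
    rw [base_eq_cons, hop_cons_base hΦ, ih]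

end Words

variable {X : Type u} [TopologicalSpace X] {x₀ : X}

namespace CGPow

instance : Subsingleton (CGPow X 0) := inferInstanceAs (Subsingleton (Fin 0 → X))

section Incl

variable {X : Type u} {x₀ : X} {n : ℕ} (j : Fin (n + 1)) (y : CGPow X n)

theorem incl_same : incl x₀ j y j = x₀ := Fin.insertNth_apply_same (α := fun _ => X) j x₀ y

theorem incl_succAbove (i : Fin n) : incl x₀ j y (j.succAbove i) = y i :=
  Fin.insertNth_apply_succAbove (α := fun _ => X) j x₀ y i

theorem eq_incl {j : Fin (n + 1)} {y : CGPow X n} {x : CGPow X (n + 1)} (hj : x j = x₀)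
    (hy : ∀ i, x (j.succAbove i) = y i) : x = incl x₀ j y :=
  Fin.eq_insertNth_iff.2 ⟨hj, funext hy⟩

theorem incl_base : incl x₀ j (base x₀ n) = base x₀ (n + 1) :=
  (eq_incl (y := base x₀ n) (x := base x₀ (n + 1)) rfl fun _ => rfl).symm

end Incl

variable (x₀) in
/-- The inclusion `CGPow.incl` as a continuous map. -/
def inclMap {n : ℕ} (j : Fin (n + 1)) : C(CGPow X n, CGPow X (n + 1)) where
  toFun := incl x₀ j
  continuous_toFun := continuous_of_apply _ fun i => by
    induction i using j.succAboveCases with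
    | x => simpa only [incl_same] using continuous_const
    | p i => simpa only [incl_succAbove] using CGPow.continuous_apply i

variable (X) in
/-- Forgetting a coordinate. -/
def forget {n : ℕ} (j : Fin (n + 1)) : C(CGPow X (n + 1), CGPow X n) :=
  mkMap fun i => coord (j.succAbove i)

theorem incl_forget {n : ℕ} {j : Fin (n + 1)} {x : CGPow X (n + 1)} (hj : x j = x₀) :
    incl x₀ j (forget X j x) = x :=
  (eq_incl hj fun _ => rfl).symm

theorem erase_eq_incl_forget {n : ℕ} (j : Fin (n + 1)) (x : CGPow X (n + 1)) :
    erase x₀ j x = incl x₀ j (forget X j x) :=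
  eq_incl ((erase_apply _ _ _).trans (if_pos rfl)) fun i =>
    (erase_apply _ _ _).trans (if_neg (Fin.succAbove_ne j i))

variable (x₀) in
/-- The inclusion `X^k → X^n` that appends base points. -/
def pad (k n : ℕ) : C(CGPow X k, CGPow X n) :=
  mkMap fun i => if h : i.val < k then coord ⟨i, h⟩ else ContinuousMap.const _ x₀

theorem pad_of_lt {k n : ℕ} (y : CGPow X k) {i : Fin n} (h : i.val < k) :
    pad x₀ k n y i = y ⟨i, h⟩ :=
  (mkMap_apply _ _ _).trans (by rw [dif_pos h]; rfl)

theorem pad_of_le {k n : ℕ} (y : CGPow X k) {i : Fin n} (h : k ≤ i.val) :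
    pad x₀ k n y i = x₀ :=
  (mkMap_apply _ _ _).trans (by rw [dif_neg h.not_gt]; rfl)

theorem pad_self (n : ℕ) (y : CGPow X n) : pad x₀ n n y = y :=
  funext fun i => pad_of_lt y i.2

theorem pad_base (k n : ℕ) : pad x₀ k n (base x₀ k) = base x₀ n :=
  funext fun i => (lt_or_ge i.val k).elim (pad_of_lt _) (pad_of_le _)

theorem pad_eq_incl_last {k n : ℕ} (hk : k ≤ n) (y : CGPow X k) :
    pad x₀ k (n + 1) y = incl x₀ (Fin.last n) (pad x₀ k n y) :=
  eq_incl (pad_of_le y hk) fun i => by rw [Fin.succAbove_last]; rfl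

theorem pad_incl {k n : ℕ} (hk : k ≤ n) (j : Fin (k + 1)) (y : CGPow X k) :
    pad x₀ (k + 1) (n + 1) (incl x₀ j y) =
      incl x₀ (Fin.castLE (Nat.succ_le_succ hk) j) (pad x₀ k n y) := by
  refine eq_incl ((pad_of_lt _ j.2).trans (incl_same j y)) fun i => ?_
  have val_succAbove (h : i.val < k) :
      (Fin.succAbove (Fin.castLE (Nat.succ_le_succ hk) j) i).val = j.succAbove ⟨i, h⟩ := by
    simp only [Fin.succAbove, Fin.lt_def, Fin.val_castSucc, Fin.val_castLE]
    split_ifs <;> rfl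
  rcases lt_or_ge i.val k with h | h
  · have lt_succ := (val_succAbove h).trans_lt (j.succAbove ⟨i, h⟩).2
    rw [pad_of_lt y h, pad_of_lt _ lt_succ, ← incl_succAbove j y]
    exact congrArg _ (Fin.ext (val_succAbove h))
  · have j_le : Fin.castLE (Nat.succ_le_succ hk) j ≤ i.castSucc :=
      Fin.le_def.2 ((Nat.lt_succ_iff.1 j.2).trans h)
    rw [pad_of_le y h, Fin.succAbove_of_le_castSucc _ _ j_le]
    exact pad_of_le _ (Nat.succ_le_succ h)

end CGPow

namespace JamesFil

variable {n : ℕ}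

/-- The map out of `J_n(X)` induced by a map out of `X^n`. -/
def lift {Y : Type*} [TopologicalSpace Y] (f : C(CGPow X n, Y))
    (hf : ∀ a b, jamesFilRel x₀ n a b → f a = f b) : C(JamesFil x₀ n, Y) where
  toFun := Quot.lift f hf
  continuous_toFun := continuous_coinduced_dom.2 f.continuous

theorem q_surjective (n : ℕ) : Function.Surjective (q x₀ n) := Quot.mk_surjective

theorem q_incl (i j : Fin (n + 1)) (y : CGPow X n) :
    q x₀ (n + 1) (CGPow.incl x₀ i y) = q x₀ (n + 1) (CGPow.incl x₀ j y) :=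
  Quot.sound (.move i j y)

theorem q_pad_incl {k : ℕ} (hk : k < n) (j : Fin (k + 1)) (y : CGPow X k) :
    q x₀ n (CGPow.pad x₀ (k + 1) n (CGPow.incl x₀ j y)) = q x₀ n (CGPow.pad x₀ k n y) := by
  obtain ⟨n, rfl⟩ := Nat.exists_eq_add_one_of_ne_zero hk.ne_bot
  rw [CGPow.pad_incl (Nat.lt_succ_iff.1 hk), CGPow.pad_eq_incl_last (Nat.lt_succ_iff.1 hk), q_incl]

theorem homotopicRel_of_comp_q {Y : Type u} [TopologicalSpace Y] {f g : C(JamesFil x₀ n, Y)}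
    (F : C(I × CGPow X n, Y)) (hF : ∀ t a b, jamesFilRel x₀ n a b → F (t, a) = F (t, b))
    (h0 : ∀ y, F (0, y) = f (q x₀ n y)) (h1 : ∀ y, F (1, y) = g (q x₀ n y))
    (hb : ∀ t, F (t, CGPow.base x₀ n) = f (base x₀ n)) : f.HomotopicRel g {base x₀ n} := by
  let F' : I × JamesFil x₀ n → Y := fun p => Quot.lift (fun y => F (p.1, y)) (hF p.1) p.2
  have q_quotient : IsQuotientMap (q x₀ n) := isQuotientMap_quot_mk
  refine homotopicRel_of_map F' (q_quotient.continuous_lift_prod_right F.continuous) ?_ ?_ ?_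
  · rintro ⟨y⟩
    exact h0 y
  · rintro ⟨y⟩
    exact h1 y
  · rintro t _ rfl
    exact hb t

end JamesFil

theorem continuous_hop {Z : Type u} [TopologicalSpace Z] [CompactlyGeneratedSpace Z] {k n : ℕ}
    {Φ : Z → (Fin k → X) → James x₀}
    (hΦ : ∀ a : Fin k → C(Z, X), Continuous fun z => Φ z fun i => a i z) (b : Fin n → C(Z, X)) :
    Continuous fun z => hop k n (Φ z) fun i => b i z := by
  induction n generalizing k with
  | zero =>
    cases k with
    | zero => simpa only [hop, Subsingleton.elim _ Fin.elim0] using hΦ Fin.elim0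
    | succ k => exact continuous_const
  | succ n ih =>
    cases k with
    | zero => simpa only [hop, Subsingleton.elim _ Fin.elim0] using hΦ Fin.elim0
    | succ k =>
      refine James.continuous_mul (ih hΦ fun i => b i.succ) (ih (fun a => ?_) fun i => b i.succ)
      convert hΦ (Fin.cons (b 0) a) using 3 with z
      funext i
      exact Fin.cases rfl (fun i => rfl) i

section HopMap

variable {k : ℕ} (Φ : C(CGPow X k, James x₀)) (hΦ : ∀ x ∈ fatWedge x₀ k, Φ x = 1)

include hΦ in
theorem hop_eq_of_jamesFilRel {n : ℕ} {a b : CGPow X n} (h : jamesFilRel x₀ n a b) :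
    hop k n Φ a = hop k n Φ b := by
  obtain ⟨i, j, y⟩ := h
  exact (hop_insertNth hΦ i y).trans (hop_insertNth hΦ j y).symm

/-- The map `J_n(X) → J(X)` induced by a map `X^k → J(X)` which is trivial on the fat wedge. -/
def hopMap (hΦ : ∀ x ∈ fatWedge x₀ k, Φ x = 1) (n : ℕ) : C(JamesFil x₀ n, James x₀) :=
  JamesFil.lift ⟨fun y => hop k n Φ y,
    continuous_hop (fun a => Φ.continuous.comp (CGPow.mkMap a).continuous) CGPow.coord⟩
    fun _ _ => hop_eq_of_jamesFilRel Φ hΦ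

theorem hopMap_q_pad {n : ℕ} (hk : k ≤ n) (y : CGPow X k) :
    hopMap Φ hΦ n (JamesFil.q x₀ n (CGPow.pad x₀ k n y)) = Φ y := by
  induction n, hk using Nat.le_induction with
  | base =>
    rw [CGPow.pad_self]
    exact hop_self Φ y
  | succ n hk ih =>
    rw [← ih, CGPow.pad_eq_incl_last hk]
    exact hop_insertNth hΦ _ _

variable (hk : k ≠ 0) (n : ℕ)
include hΦ hk

theorem hopMap_base : hopMap Φ hΦ n (JamesFil.base x₀ n) = 1 := hop_base hk n hΦ

variable {Φ} in
theorem hopMap_homotopicRel_one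
    (h : Φ.HomotopicRel (ContinuousMap.const _ 1) (fatWedge x₀ k)) :
    (hopMap Φ hΦ n).HomotopicRel (ContinuousMap.const _ 1) {JamesFil.base x₀ n} := by
  obtain ⟨K⟩ := h
  let Φ_ (t : I) : C(CGPow X k, James x₀) := K.toContinuousMap.curry t
  have Φ_trivial (t : I) : ∀ x ∈ fatWedge x₀ k, Φ_ t x = 1 :=
    fun x hx => (K.eq_fst t hx).trans (hΦ x hx)
  have Φ_zero : (Φ_ 0 : (Fin k → X) → James x₀) = Φ := funext K.apply_zero
  have Φ_one : (Φ_ 1 : (Fin k → X) → James x₀) = fun _ => 1 := funext K.apply_one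
  refine JamesFil.homotopicRel_of_comp_q ⟨fun p => hop k n (Φ_ p.1) p.2, ?_⟩
    (fun t _ _ => hop_eq_of_jamesFilRel (Φ_ t) (Φ_trivial t)) (fun y => ?_) (fun y => ?_)
    fun t => ?_
  · exact continuous_hop (fun a => K.continuous.comp
      (continuous_fst.prodMk (CGPow.mkMap a).continuous)) fun i => (CGPow.coord i).comp .snd
  · exact congrArg (fun Ψ => hop k n Ψ y) Φ_zero
  · exact (congrArg (fun Ψ => hop k n Ψ y) Φ_one).trans (hop_one k n y)
  · exact (hopMap_base (Φ_ t) (Φ_trivial t) hk n).trans (hopMap_base Φ hΦ hk n).symm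

end HopMap

end JamesHopf

section Injectivity

open unitInterval

variable {X : Type u} [TopologicalSpace X] {x₀ : X}

namespace NDRData

variable (N : NDRData x₀) {n : ℕ}

theorem pow_incl (t : I) (j : Fin (n + 1)) (y : CGPow X n) :
    N.pow (n + 1) (t, CGPow.incl x₀ j y) = CGPow.incl x₀ j (N.pow n (t, y)) :=
  CGPow.eq_incl (N.pow_of_base t (CGPow.incl_same j y)) fun i =>
    congrArg (fun x => N.h (t, x)) (CGPow.incl_succAbove j y i)

theorem q_pow_eq (t : I) {a b : CGPow X n} (h : jamesFilRel x₀ n a b) :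
    JamesFil.q x₀ n (N.pow n (t, a)) = JamesFil.q x₀ n (N.pow n (t, b)) := by
  obtain ⟨i, j, y⟩ := h
  rw [N.pow_incl, N.pow_incl, JamesFil.q_incl]

variable (n) in
/-- The map `J_n(X) → J_n(X)` induced by `NDRData.powOne`. -/
def filOne : C(JamesFil x₀ n, JamesFil x₀ n) :=
  JamesFil.lift ((JamesFil.q x₀ n).comp (N.powOne n)) fun _ _ => N.q_pow_eq 1

theorem filOne_q (y : CGPow X n) :
    N.filOne n (JamesFil.q x₀ n y) = JamesFil.q x₀ n (N.powOne n y) := rfl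

theorem filOne_base : N.filOne n (JamesFil.base x₀ n) = JamesFil.base x₀ n :=
  congrArg _ N.powOne_base

theorem homotopicRel_comp_filOne {Y : Type u} [TopologicalSpace Y] (f : C(JamesFil x₀ n, Y)) :
    f.HomotopicRel (f.comp (N.filOne n)) {JamesFil.base x₀ n} :=
  JamesFil.homotopicRel_of_comp_q ((f.comp (JamesFil.q x₀ n)).comp (N.pow n))
    (fun t _ _ h => congrArg f (N.q_pow_eq t h))
    (fun y => congrArg (fun z => f (JamesFil.q x₀ n z)) (N.pow_zero y)) (fun _ => rfl)
    fun t => congrArg (fun z => f (JamesFil.q x₀ n z)) (N.pow_base t)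

theorem sum_height_incl (j : Fin (n + 1)) (y : CGPow X n) :
    ∑ i, N.height i (CGPow.incl x₀ j y) = ∑ i, N.height i y := by
  rw [Fin.sum_univ_succAbove _ j, N.height_of_base (CGPow.incl_same j y), zero_add]
  exact Finset.sum_congr rfl fun i _ =>
    congrArg (fun x => (N.v x : ℝ)) (CGPow.incl_succAbove j y i)

variable (n) in
/-- The sum of the heights of all coordinates. -/
def totalHeight : C(JamesFil x₀ n, ℝ) :=
  JamesFil.lift ⟨fun y => ∑ i, N.height i y, by fun_prop⟩ (by
    rintro _ _ ⟨i, j, y⟩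
    exact (N.sum_height_incl i y).trans (N.sum_height_incl j y).symm)

theorem height_le_one (i : Fin n) (y : CGPow X n) : N.height i y ≤ 1 := (N.v (y i)).2.2

theorem totalHeight_q_pad_le {k : ℕ} (hk : k ≤ n) (a : CGPow X k) :
    N.totalHeight n (JamesFil.q x₀ n (CGPow.pad x₀ k n a)) ≤ k := by
  induction n, hk using Nat.le_induction with
  | base =>
    rw [CGPow.pad_self]
    calc ∑ i, N.height i a ≤ ∑ _i : Fin k, (1 : ℝ) :=
          Finset.sum_le_sum fun i _ => N.height_le_one i a
      _ = k := by simp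
  | succ n hk ih =>
    rw [CGPow.pad_eq_incl_last hk]
    exact (N.sum_height_incl _ _).trans_le ih

theorem sum_height_forget_le (j : Fin (n + 1)) (y : CGPow X (n + 1)) :
    ∑ i, N.height i (CGPow.forget X j y) ≤ ∑ i, N.height i y := by
  rw [Fin.sum_univ_succAbove (fun i => N.height i y) j]
  exact le_add_of_nonneg_left (N.v (y j)).2.1

theorem exists_height_lt_one {k : ℕ} (hk : k ≤ n) {y : CGPow X (n + 1)}
    (hy : ∑ i, N.height i y < k + 1) : ∃ j, N.height j y < 1 := by
  by_contra! h
  have k_le_n : (k : ℝ) ≤ n := Nat.cast_le.2 hk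
  have n_succ_le : (n + 1 : ℝ) ≤ ∑ i, N.height i y :=
    calc (n + 1 : ℝ) = ∑ _i : Fin (n + 1), (1 : ℝ) := by simp
      _ ≤ _ := Finset.sum_le_sum fun i _ => h i
  linarith

theorem powOne_eq_incl {j : Fin (n + 1)} {y : CGPow X (n + 1)} (hj : N.height j y < 1) :
    N.powOne (n + 1) y = CGPow.incl x₀ j (N.powOne n (CGPow.forget X j y)) :=
  CGPow.eq_incl (N.h_one _ (Subtype.coe_lt_coe.1 hj)) fun _ => rfl

theorem exists_q_pad_eq_q_pad_powOne {k m : ℕ} (hkm : k ≤ m) (hmn : m ≤ n) (y : CGPow X m)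
    (hy : ∑ i, N.height i y < k + 1) : ∃ a : CGPow X k,
      JamesFil.q x₀ n (CGPow.pad x₀ k n a) = JamesFil.q x₀ n (CGPow.pad x₀ m n (N.powOne m y)) := by
  induction m, hkm using Nat.le_induction with
  | base => exact ⟨N.powOne k y, rfl⟩
  | succ m hk ih =>
    obtain ⟨j, hj⟩ := N.exists_height_lt_one hk hy
    obtain ⟨a, ha⟩ := ih (Nat.le_of_succ_le hmn) (CGPow.forget X j y)
      ((N.sum_height_forget_le j y).trans_lt hy)
    exact ⟨a, by rw [ha, N.powOne_eq_incl hj, JamesFil.q_pad_incl hmn]⟩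

-- The deformation kills every letter of height less than `1`, so that at most `k` survive.
theorem exists_q_pad_eq_filOne {k : ℕ} (hk : k ≤ n) {z : JamesFil x₀ n}
    (hz : N.totalHeight n z < k + 1) :
    ∃ a : CGPow X k, JamesFil.q x₀ n (CGPow.pad x₀ k n a) = N.filOne n z := by
  obtain ⟨y, rfl⟩ := JamesFil.q_surjective n z
  obtain ⟨a, ha⟩ := N.exists_q_pad_eq_q_pad_powOne hk le_rfl y hz
  exact ⟨a, by rw [ha, CGPow.pad_self, N.filOne_q]⟩

variable (D : James.Inversion x₀)
include N D

theorem exists_eq_one_on_pad {k : ℕ} (hk : k < n) (b : C(JamesFil x₀ n, James x₀))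
    (hq : (b.comp (JamesFil.q x₀ n)).Homotopic (ContinuousMap.const _ 1))
    (hb : ∀ y : CGPow X k, b (JamesFil.q x₀ n (CGPow.pad x₀ k n y)) = 1) :
    ∃ b' : C(JamesFil x₀ n, James x₀), b'.HomotopicRel b {JamesFil.base x₀ n} ∧
      ∀ y : CGPow X (k + 1), b' (JamesFil.q x₀ n (CGPow.pad x₀ (k + 1) n y)) = 1 := by
  let Φ := (b.comp (JamesFil.q x₀ n)).comp (CGPow.pad x₀ (k + 1) n)
  have Φ_trivial : ∀ x ∈ fatWedge x₀ (k + 1), Φ x = 1 := by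
    rintro x ⟨i, hi⟩
    rw [← hb (CGPow.forget X i x), ← JamesFil.q_pad_incl hk i, CGPow.incl_forget hi]
    rfl
  let g := hopMap Φ Φ_trivial n
  have g_null : g.HomotopicRel (ContinuousMap.const _ 1) {JamesFil.base x₀ n} :=
    hopMap_homotopicRel_one Φ_trivial k.succ_ne_zero n
      (N.homotopicRel_fatWedge_of_homotopic D Φ_trivial (hq.comp (.refl _)))
  let u : C(JamesFil x₀ n, ℝ) := N.totalHeight n - ContinuousMap.const _ (k + 1 : ℝ)
  have eq_of_le : ∀ z, u z ≤ 1 / 2 → b.comp (N.filOne n) z = g.comp (N.filOne n) z := by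
    intro z hz
    replace hz : N.totalHeight n z - (k + 1 : ℝ) ≤ 1 / 2 := hz
    obtain ⟨a, ha⟩ := N.exists_q_pad_eq_filOne hk (z := z) (by push_cast; linarith)
    rw [ContinuousMap.comp_apply, ContinuousMap.comp_apply, ← ha, hopMap_q_pad Φ Φ_trivial hk]
    rfl
  have b_base : b (JamesFil.base x₀ n) = 1 := by
    rw [← hb (CGPow.base x₀ k), CGPow.pad_base]
    rfl
  refine ⟨D.kill _ _ u eq_of_le, D.kill_homotopicRel_of_null eq_of_le
    (homotopicRel_comp_right g_null (N.filOne n) (by simp [N.filOne_base]))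
    (N.homotopicRel_comp_filOne b).symm (by simp [N.filOne_base, b_base]),
    fun y => D.kill_of_nonpos eq_of_le (sub_nonpos.2 ?_)⟩
  exact (N.totalHeight_q_pad_le hk y).trans_eq (Nat.cast_succ k)

theorem homotopicRel_one_of_comp_q (b : C(JamesFil x₀ n, James x₀))
    (hq : (b.comp (JamesFil.q x₀ n)).HomotopicRel (ContinuousMap.const _ 1) {CGPow.base x₀ n}) :
    b.HomotopicRel (ContinuousMap.const _ 1) {JamesFil.base x₀ n} := by
  have exists_trivial (k : ℕ) (hk : k ≤ n) : ∃ b' : C(JamesFil x₀ n, James x₀),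
      b'.HomotopicRel b {JamesFil.base x₀ n} ∧
        ∀ y : CGPow X k, b' (JamesFil.q x₀ n (CGPow.pad x₀ k n y)) = 1 := by
    induction k with
    | zero =>
      refine ⟨b, .refl _, fun y => ?_⟩
      rw [Subsingleton.elim y (CGPow.base x₀ 0), CGPow.pad_base]
      exact hq.fst_eq_snd rfl
    | succ k ih =>
      obtain ⟨b₁, b₁_homotopic, b₁_trivial⟩ := ih (Nat.le_of_succ_le hk)
      have b₁_q_null : (b₁.comp (JamesFil.q x₀ n)).Homotopic (ContinuousMap.const _ 1) :=
        (b₁_homotopic.homotopic.comp (.refl _)).trans hq.homotopic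
      obtain ⟨b₂, b₂_homotopic, b₂_trivial⟩ := N.exists_eq_one_on_pad D hk b₁ b₁_q_null b₁_trivial
      exact ⟨b₂, b₂_homotopic.trans b₁_homotopic, b₂_trivial⟩
  obtain ⟨b', b'_homotopic, b'_trivial⟩ := exists_trivial n le_rfl
  have b'_eq : b' = ContinuousMap.const _ 1 := ContinuousMap.ext fun z => by
    obtain ⟨y, rfl⟩ := JamesFil.q_surjective n z
    rw [← CGPow.pad_self n y]
    exact b'_trivial y
  exact b'_eq ▸ b'_homotopic.symm

theorem qStar_injective (n : ℕ) : Function.Injective (qStar x₀ n) := by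
  have eq_one_of_qStar : ∀ β, qStar x₀ n β = 1 → β = 1 := by
    rintro ⟨b, hb⟩ h
    exact Quotient.sound (N.homotopicRel_one_of_comp_q D b (Quotient.exact h))
  intro a b hab
  obtain ⟨a, rfl⟩ := D.isUnit a
  refine Units.inv_mul_eq_one.1 (eq_one_of_qStar _ ?_)
  rw [map_mul, ← hab, ← map_mul, Units.inv_mul, map_one]

end NDRData

end Injectivity

namespace HoClass

section Precomp

variable {X : Type u} [TopologicalSpace X] {x₀ : X}
  {Z Y W : Type u} [TopologicalSpace Z] [CompactlyGeneratedSpace Z]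
  [TopologicalSpace Y] [CompactlyGeneratedSpace Y] [TopologicalSpace W] [CompactlyGeneratedSpace W]

theorem precomp_precomp {z₀ : Z} {y₀ : Y} {w₀ : W} (q : C(Z, Y)) (hq : q z₀ = y₀)
    (r : C(Y, W)) (hr : r y₀ = w₀) (s : C(Z, W)) (hs : s z₀ = w₀) (h : ∀ z, r (q z) = s z)
    (a : HoClass w₀ (1 : James x₀)) : precomp q hq (precomp r hr a) = precomp s hs a := by
  obtain rfl : r.comp q = s := ContinuousMap.ext h
  obtain ⟨a⟩ := a
  rfl

theorem precomp_eq_self {z₀ : Z} (q : C(Z, Z)) (hq : q z₀ = z₀) (h : ∀ z, q z = z)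
    (a : HoClass z₀ (1 : James x₀)) : precomp q hq a = a := by
  obtain rfl : q = ContinuousMap.id Z := ContinuousMap.ext h
  obtain ⟨a⟩ := a
  rfl

theorem eq_one_of_subsingleton [Subsingleton Z] {z₀ : Z} (a : HoClass z₀ (1 : James x₀)) :
    a = 1 := by
  obtain ⟨f, hf⟩ := a
  refine congrArg (Quotient.mk _) (Subtype.ext (ContinuousMap.ext fun z => ?_))
  rw [Subsingleton.elim z z₀]
  exact hf

end Precomp

section Face

variable {X : Type u} [TopologicalSpace X] {x₀ : X}

variable (x₀) in
/-- The `j`-th face map `[X^{n+1}, J(X)] → [X^n, J(X)]`, induced by inserting the base point in the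
`j`-th place. -/
def face {n : ℕ} (j : Fin (n + 1)) :
    HoClass (CGPow.base x₀ (n + 1)) (1 : James x₀) →* HoClass (CGPow.base x₀ n) (1 : James x₀) :=
  precomp (CGPow.inclMap x₀ j) (CGPow.incl_base j)

variable (x₀) in
/-- The map `[X^n, J(X)] → [X^k, J(X)]` induced by `CGPow.pad`; for `k ≤ n` it restricts to the
first `k` coordinates. -/
def padStar (k n : ℕ) :
    HoClass (CGPow.base x₀ n) (1 : James x₀) →* HoClass (CGPow.base x₀ k) (1 : James x₀) :=
  precomp (CGPow.pad x₀ k n) (CGPow.pad_base k n)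

theorem precomp_erase {k : ℕ} (j : Fin (k + 1))
    (a : HoClass (CGPow.base x₀ (k + 1)) (1 : James x₀)) :
    precomp (CGPow.erase x₀ j) (CGPow.erase_base j) a =
      precomp (CGPow.forget X j) (y₀ := CGPow.base x₀ k) rfl (face x₀ j a) :=
  (precomp_precomp _ _ _ _ _ _ (fun y => (CGPow.erase_eq_incl_forget j y).symm) a).symm

theorem face_qStar {n : ℕ} (i j : Fin (n + 1))
    (b : HoClass (JamesFil.base x₀ (n + 1)) (1 : James x₀)) :
    face x₀ i (qStar x₀ (n + 1) b) = face x₀ j (qStar x₀ (n + 1) b) := by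
  obtain ⟨b, hb⟩ := b
  exact congrArg (Quotient.mk _) (Subtype.ext (ContinuousMap.ext fun y =>
    congrArg b (JamesFil.q_incl i j y)))

theorem face_padStar {k m : ℕ} (hk : k ≤ m) (j : Fin (k + 1))
    (a : HoClass (CGPow.base x₀ (m + 1)) (1 : James x₀))
    (ha : ∀ i j, face x₀ i a = face x₀ j a) :
    face x₀ j (padStar x₀ (k + 1) (m + 1) a) = padStar x₀ k (m + 1) a := by
  have face_padStar_eq : face x₀ j (padStar x₀ (k + 1) (m + 1) a) =
      padStar x₀ k m (face x₀ (Fin.castLE (Nat.succ_le_succ hk) j) a) := by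
    obtain ⟨f, hf⟩ := a
    exact congrArg (Quotient.mk _) (Subtype.ext (ContinuousMap.ext fun y =>
      congrArg f (CGPow.pad_incl hk j y)))
  rw [face_padStar_eq, ha _ (Fin.last m)]
  exact precomp_precomp _ _ _ _ _ _ (fun y => (CGPow.pad_eq_incl_last hk y).symm) a

end Face

end HoClass

namespace NDRData

variable {X : Type u} [TopologicalSpace X] {x₀ : X} (N : NDRData x₀) (D : James.Inversion x₀)
include N D

theorem exists_rep_eq_one_on_fatWedge {k : ℕ} (a : HoClass (CGPow.base x₀ k) (1 : James x₀))
    (ha : ∀ j, HoClass.precomp (CGPow.erase x₀ j) (CGPow.erase_base j) a = 1) :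
    ∃ (Φ : C(CGPow X k, James x₀)) (hb : Φ (CGPow.base x₀ k) = 1),
      (∀ x ∈ fatWedge x₀ k, Φ x = 1) ∧ HoClass.mk Φ hb = a := by
  obtain ⟨f, hf⟩ := a
  obtain ⟨Φ, Φ_trivial, Φ_homotopic⟩ :=
    N.exists_eq_one_on_fatWedge D hf fun j => Quotient.exact (ha j)
  exact ⟨Φ, (Φ_homotopic.fst_eq_snd rfl).trans hf, Φ_trivial, Quotient.sound Φ_homotopic⟩

theorem exists_padStar_qStar_eq {k m : ℕ} (hk : k ≤ m)
    (a : HoClass (CGPow.base x₀ (m + 1)) (1 : James x₀))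
    (ha : ∀ i j, HoClass.face x₀ i a = HoClass.face x₀ j a)
    (ha_pad : HoClass.padStar x₀ k (m + 1) a = 1) :
    ∃ b, HoClass.padStar x₀ (k + 1) (m + 1) (qStar x₀ (m + 1) b) =
      HoClass.padStar x₀ (k + 1) (m + 1) a := by
  obtain ⟨Φ, hb, hΦ, h_mk⟩ := N.exists_rep_eq_one_on_fatWedge D
    (HoClass.padStar x₀ (k + 1) (m + 1) a) fun j => by
      rw [HoClass.precomp_erase, HoClass.face_padStar hk j a ha, ha_pad, map_one]
  refine ⟨HoClass.mk (hopMap Φ hΦ (m + 1)) (hopMap_base Φ hΦ k.succ_ne_zero (m + 1)), ?_⟩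
  rw [← h_mk]
  exact congrArg (Quotient.mk _) (Subtype.ext (ContinuousMap.ext fun y =>
    hopMap_q_pad Φ hΦ (Nat.succ_le_succ hk) y))

theorem exists_qStar_eq_of_padStar_eq_one {k m : ℕ} (hk : k ≤ m + 1)
    (a : HoClass (CGPow.base x₀ (m + 1)) (1 : James x₀))
    (ha : ∀ i j, HoClass.face x₀ i a = HoClass.face x₀ j a)
    (ha_pad : HoClass.padStar x₀ k (m + 1) a = 1) : ∃ b, qStar x₀ (m + 1) b = a := by
  induction hk using Nat.decreasingInduction generalizing a with
  | self =>
    refine ⟨1, ?_⟩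
    rw [map_one, ← ha_pad]
    exact HoClass.precomp_eq_self _ _ (CGPow.pad_self _) a
  | of_succ k hk ih =>
    obtain ⟨b, hb⟩ := N.exists_padStar_qStar_eq D (Nat.le_of_lt_succ hk) a ha ha_pad
    obtain ⟨b, rfl⟩ := D.isUnit b
    obtain ⟨c, hc⟩ := ih (a * qStar x₀ (m + 1) ↑b⁻¹)
      (fun i j => by rw [map_mul, map_mul, ha i j, HoClass.face_qStar i j])
      (by rw [map_mul, ← hb, ← map_mul, ← map_mul, Units.mul_inv, map_one, map_one])
    refine ⟨c * b, ?_⟩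
    rw [map_mul, hc, mul_assoc, ← map_mul, Units.inv_mul, map_one, mul_one]

theorem exists_qStar_eq {m : ℕ} (a : HoClass (CGPow.base x₀ (m + 1)) (1 : James x₀))
    (ha : ∀ i j, HoClass.face x₀ i a = HoClass.face x₀ j a) : ∃ b, qStar x₀ (m + 1) b = a :=
  N.exists_qStar_eq_of_padStar_eq_one D (Nat.zero_le _) a ha (HoClass.eq_one_of_subsingleton _)

end NDRData

section DuplicatedCoordinate

open unitInterval

variable {X : Type u} [TopologicalSpace X] {x₀ : X} {k n : ℕ}

-- A product of quotient maps need not be a quotient map, so the continuity is checked after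
-- currying, which the local compactness of `S` allows.
theorem SmashPow.continuous_uncurry {S Y : Type u} [TopologicalSpace S] [LocallyCompactSpace S]
    [TopologicalSpace Y] {F : SmashPow x₀ k → S → Y}
    (hF : ∀ (K : CompHaus.{u}) (b : C(K, CGPow X k)),
      Continuous fun p : K × S => F (Quot.mk _ (b p.1)) p.2) :
    Continuous fun p : SmashPow x₀ k × S => F p.1 p.2 := by
  have continuous_slice : ∀ w, Continuous (F w) := by
    rintro ⟨z⟩
    exact (hF (CompHaus.of PUnit) (ContinuousMap.const _ z)).comp
      (Continuous.prodMk_right PUnit.unit)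
  let G : SmashPow x₀ k → C(S, Y) := fun w => ⟨F w, continuous_slice w⟩
  have continuous_G : Continuous G :=
    continuous_coinduced_dom.2 <| continuous_from_uCompactlyGeneratedSpace _ fun K b =>
      ContinuousMap.continuous_of_continuous_uncurry _ (hF K b)
  exact ContinuousMap.continuous_uncurry_of_continuous ⟨G, continuous_G⟩

namespace CGPow

variable (X) in
/-- The map of powers of `X` induced by a map of index sets. -/
def reindex (c : Fin k → Fin n) : C(CGPow X n, CGPow X k) := mkMap fun s => coord (c s)

/-- The reindexed tuple `reindex X c x` with its entries in the places `s` and `t` replaced by those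
of the pair `z`. -/
def glue (c : Fin k → Fin n) (s t : Fin k) (z : CGPow X 2) (x : CGPow X n) : CGPow X k :=
  fun i => if i = s then z 0 else if i = t then z 1 else x (c i)

theorem glue_diagonal {c : Fin k → Fin n} {s t : Fin k} (hc : c s = c t) (x : CGPow X n) :
    glue c s t (fun _ => x (c s)) x = reindex X c x := by
  refine funext fun i => ?_
  change (if i = s then x (c s) else if i = t then x (c s) else x (c i)) = x (c i)
  split_ifs with his hit
  · rw [his]
  · rw [hit, hc]
  · rfl

omit [TopologicalSpace X] in
theorem glue_mem_fatWedge (c : Fin k → Fin n) {s t : Fin k} (hst : s ≠ t) {z : CGPow X 2}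
    (hz : ∃ i, z i = x₀) (x : CGPow X n) : glue c s t z x ∈ fatWedge x₀ k := by
  obtain hz | hz := Fin.exists_fin_two.1 hz
  · exact ⟨s, by simp [glue, hz]⟩
  · exact ⟨t, by simp [glue, hz, hst.symm]⟩

theorem continuous_glue (c : Fin k → Fin n) (s t : Fin k) (K L : CompHaus.{u})
    (b : C(K, CGPow X 2)) (q : C(L, CGPow X n)) :
    Continuous fun p : K × L => glue c s t (b p.1) (q p.2) := by
  refine continuous_of_compHaus (CompHaus.of (K × L)) _ fun i => ?_
  have continuous_b := b.continuous.comp (continuous_fst (X := K) (Y := L))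
  have continuous_q := q.continuous.comp (continuous_snd (X := K) (Y := L))
  simp only [glue]
  split_ifs
  · exact (continuous_apply 0).comp continuous_b
  · exact (continuous_apply 1).comp continuous_b
  · exact (continuous_apply (c i)).comp continuous_q

end CGPow

section Glue

variable {Y : Type u} [TopologicalSpace Y] {y₀ : Y} (Φ : C(CGPow X k, Y))
  (hΦ : ∀ x ∈ fatWedge x₀ k, Φ x = y₀) (c : Fin k → Fin n) {s t : Fin k} (hst : s ≠ t)

/-- The map `X^{(2)} × X^n → Y` induced by `Φ` and `CGPow.glue`, for `Φ` trivial on the fat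
wedge. -/
def smashGlue (w : SmashPow x₀ 2) (x : CGPow X n) : Y :=
  Quot.lift (fun z => Φ (CGPow.glue c s t z x)) (fun _ _ h =>
    (hΦ _ (CGPow.glue_mem_fatWedge c hst h.1 x)).trans
      (hΦ _ (CGPow.glue_mem_fatWedge c hst h.2 x)).symm) w

theorem smashGlue_base (x : CGPow X n) : smashGlue Φ hΦ c hst (SmashPow.base x₀ 2) x = y₀ :=
  hΦ _ (CGPow.glue_mem_fatWedge c hst ⟨0, rfl⟩ x)

theorem continuous_smashGlue (L : CompHaus.{u}) (q : C(L, CGPow X n)) :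
    Continuous fun p : SmashPow x₀ 2 × L => smashGlue Φ hΦ c hst p.1 (q p.2) := by
  have : LocallyCompactSpace L := locallyCompactSpace_of_compact_t2 L
  exact SmashPow.continuous_uncurry (F := fun w p => smashGlue Φ hΦ c hst w (q p)) fun K b =>
    Φ.continuous.comp (CGPow.continuous_glue c s t K L b q)

variable [CompactlyGeneratedSpace X]

theorem smashGlue_reducedDiagonal (hc : c s = c t) (x : CGPow X n) :
    smashGlue Φ hΦ c hst (reducedDiagonal x₀ 2 (x (c s))) x = Φ (CGPow.reindex X c x) :=
  congrArg Φ (CGPow.glue_diagonal hc x)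

include hΦ hst in
theorem homotopicRel_const_of_weakLSCatLT (hcat : WeakLSCatLT x₀ 2) (hc : c s = c t) :
    (Φ.comp (CGPow.reindex X c)).HomotopicRel (ContinuousMap.const _ y₀) {CGPow.base x₀ n} := by
  obtain ⟨H⟩ := hcat
  refine homotopicRel_of_map
    (fun p => smashGlue Φ hΦ c hst (H (p.1, p.2 (c s))) p.2) ?_ (fun x => ?_) (fun x => ?_) ?_
  · refine continuous_from_uCompactlyGeneratedSpace _ fun L q => ?_
    have continuous_H : Continuous fun p : L => H ((q p).1, (q p).2 (c s)) :=
      H.continuous.comp ((continuous_fst.comp q.continuous).prodMk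
        ((CGPow.continuous_apply (c s)).comp (continuous_snd.comp q.continuous)))
    exact (continuous_smashGlue Φ hΦ c hst L (ContinuousMap.snd.comp q)).comp
      (continuous_H.prodMk continuous_id)
  · rw [H.apply_zero]
    exact smashGlue_reducedDiagonal Φ hΦ c hst hc x
  · rw [H.apply_one]
    exact smashGlue_base Φ hΦ c hst x
  · rintro τ _ rfl
    exact (congrArg (smashGlue Φ hΦ c hst · _) (H.eq_fst τ rfl)).trans
      (smashGlue_reducedDiagonal Φ hΦ c hst hc _)

end Glue

end DuplicatedCoordinate

namespace CohenK

variable {G : Type*} [Group G] {n : ℕ}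

/-- The homomorphism from the Cohen group determined by a family of elements whose iterated
commutators with a repeated entry are trivial. -/
def lift (x : Fin n → G) (hx : ∀ (l : ℕ) (c : Fin (l + 1) → Fin n), (∃ s t, s < t ∧ c s = c t) →
    (iterComm l fun s => x (c s)) = 1) : CohenK n →* G :=
  PresentedGroup.toGroup (f := x) (by
    rintro r (⟨l, i, h, rfl⟩ | ⟨l, i, m, rfl⟩)
    · simpa only [map_iterComm, FreeGroup.lift_apply_of] using hx l i h
    · rw [map_mul, map_inv, map_zpow, map_iterComm, map_iterComm, mul_inv_eq_one]
      simpa only [map_zpow, FreeGroup.lift_apply_of] using iterComm_zpow hx l i m)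

section Lift

variable {x : Fin n → G} (hx : ∀ (l : ℕ) (c : Fin (l + 1) → Fin n),
  (∃ s t, s < t ∧ c s = c t) → (iterComm l fun s => x (c s)) = 1)

theorem lift_x (i : Fin n) : lift x hx (CohenK.x i) = x i := PresentedGroup.toGroup.of _

theorem lift_mem_closure (a : CohenK n) : lift x hx a ∈ Subgroup.closure (Set.range x) := by
  suffices h : (⊤ : Subgroup (CohenK n)) ≤ (Subgroup.closure (Set.range x)).comap (lift x hx) from
    h (Subgroup.mem_top a)
  rw [← PresentedGroup.closure_range_of, Subgroup.closure_le]
  rintro _ ⟨i, rfl⟩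
  exact Subgroup.subset_closure ⟨i, (lift_x hx i).symm⟩

end Lift

theorem d_x_same (j : Fin (n + 1)) : d j (x j) = 1 :=
  (PresentedGroup.toGroup.of _).trans (Fin.insertNth_apply_same _ _ _)

theorem d_x_succAbove (j : Fin (n + 1)) (i : Fin n) : d j (x (j.succAbove i)) = x i :=
  (PresentedGroup.toGroup.of _).trans (Fin.insertNth_apply_succAbove _ _ _ _)

theorem d_eq_d {a : CohenK (n + 1)} (ha : a ∈ cohenH (n + 1)) (i j : Fin (n + 1)) :
    d i a = d j a :=
  Subgroup.mem_iInf.1 (Subgroup.mem_iInf.1 ha i) j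

end CohenK

section Classes

variable {X : Type u} [TopologicalSpace X] [CompactlyGeneratedSpace X] {x₀ : X} {n : ℕ}

namespace James.Inversion

variable (D : James.Inversion x₀)

/-- The class `x_i ∈ [X^n, J(X)]` as an invertible element. -/
noncomputable def xUnit (i : Fin n) : (HoClass (CGPow.base x₀ n) (1 : James x₀))ˣ :=
  (D.isUnit (xClass x₀ i)).unit

theorem face_xUnit_same (j : Fin (n + 1)) : Units.map (HoClass.face x₀ j) (D.xUnit j) = 1 :=
  Units.ext <| congrArg (Quotient.mk _) <| Subtype.ext <| ContinuousMap.ext fun y =>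
    (congrArg (James.of x₀) (CGPow.incl_same j y)).trans James.of_base

theorem face_xUnit_succAbove (j : Fin (n + 1)) (i : Fin n) :
    Units.map (HoClass.face x₀ j) (D.xUnit (j.succAbove i)) = D.xUnit i :=
  Units.ext <| congrArg (Quotient.mk _) <| Subtype.ext <| ContinuousMap.ext fun y =>
    congrArg (James.of x₀) (CGPow.incl_succAbove j y i)

theorem reindex_xUnit {k : ℕ} (c : Fin k → Fin n) (s : Fin k) :
    Units.map (HoClass.precomp (x₀ := x₀) (CGPow.reindex X c) (y₀ := CGPow.base x₀ k) rfl)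
      (D.xUnit s) = D.xUnit (c s) :=
  Units.ext rfl

end James.Inversion

namespace NDRData

variable (N : NDRData x₀) (D : James.Inversion x₀)

include N in
theorem exists_rep_iterComm_xUnit (l : ℕ) :
    ∃ (Φ : C(CGPow X (l + 1), James x₀)) (hb : Φ (CGPow.base x₀ (l + 1)) = 1),
      (∀ x ∈ fatWedge x₀ (l + 1), Φ x = 1) ∧
        HoClass.mk Φ hb = (iterComm l (D.xUnit (n := l + 1))).val := by
  refine N.exists_rep_eq_one_on_fatWedge D _ fun j => ?_
  have face_units_eq_one : Units.map (HoClass.face x₀ j) (iterComm l D.xUnit) = 1 := by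
    rw [map_iterComm]
    exact iterComm_eq_one l _ ⟨j, D.face_xUnit_same j⟩
  have face_eq_one : HoClass.face x₀ j (iterComm l D.xUnit).val = 1 :=
    congrArg Units.val face_units_eq_one
  rw [HoClass.precomp_erase, face_eq_one, map_one]

variable (hcat : WeakLSCatLT x₀ 2)

include N hcat in
theorem iterComm_xUnit_eq_one (l : ℕ) (c : Fin (l + 1) → Fin n) (h : ∃ s t, s < t ∧ c s = c t) :
    (iterComm l fun s => D.xUnit (c s)) = 1 := by
  obtain ⟨s, t, hst, hc⟩ := h
  obtain ⟨Φ, hb, hΦ, h_mk⟩ := N.exists_rep_iterComm_xUnit D l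
  calc (iterComm l fun s => D.xUnit (c s))
      = Units.map (HoClass.precomp (x₀ := x₀) (CGPow.reindex X c)
          (y₀ := CGPow.base x₀ (l + 1)) rfl) (iterComm l D.xUnit) := by
        simp only [map_iterComm, D.reindex_xUnit]
    _ = 1 := Units.ext ?_
  rw [Units.coe_map, ← h_mk]
  exact Quotient.sound (homotopicRel_const_of_weakLSCatLT Φ hΦ c hst.ne hcat hc)

/-- The homomorphism from the Cohen group to the invertible classes in `[X^n, J(X)]`. -/
noncomputable def cohenRep (n : ℕ) : CohenK n →* (HoClass (CGPow.base x₀ n) (1 : James x₀))ˣ :=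
  CohenK.lift D.xUnit (N.iterComm_xUnit_eq_one D hcat)

theorem cohenRep_x (i : Fin n) : N.cohenRep D hcat n (CohenK.x i) = D.xUnit i :=
  CohenK.lift_x _ i

theorem cohenRep_mem_geomK (a : CohenK n) : (N.cohenRep D hcat n a).val ∈ geomK x₀ n := by
  refine ⟨N.cohenRep D hcat n a, Subgroup.closure_mono ?_ (CohenK.lift_mem_closure _ a), rfl⟩
  rintro _ ⟨i, rfl⟩
  exact ⟨i, rfl⟩

theorem face_cohenRep (j : Fin (n + 1)) (a : CohenK (n + 1)) :
    HoClass.face x₀ j (N.cohenRep D hcat (n + 1) a).val =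
      N.cohenRep D hcat n (CohenK.d j a) := by
  suffices hom_eq : (Units.map (HoClass.face x₀ j)).comp (N.cohenRep D hcat (n + 1)) =
      (N.cohenRep D hcat n).comp (CohenK.d j) from congrArg Units.val (DFunLike.congr_fun hom_eq a)
  refine PresentedGroup.ext fun i => ?_
  change Units.map (HoClass.face x₀ j) (N.cohenRep D hcat (n + 1) (CohenK.x i)) =
    N.cohenRep D hcat n (CohenK.d j (CohenK.x i))
  induction i using j.succAboveCases with
  | x => rw [cohenRep_x, D.face_xUnit_same, CohenK.d_x_same, map_one]
  | p i => rw [cohenRep_x, D.face_xUnit_succAbove, CohenK.d_x_succAbove, cohenRep_x]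

theorem exists_qStar_eq_cohenRep {a : CohenK n} (ha : a ∈ cohenH n) :
    ∃ b, qStar x₀ n b = N.cohenRep D hcat n a := by
  cases n with
  | zero => exact ⟨1, (map_one _).trans (HoClass.eq_one_of_subsingleton _).symm⟩
  | succ n =>
    refine N.exists_qStar_eq D _ fun i j => ?_
    rw [face_cohenRep, face_cohenRep, CohenK.d_eq_d ha i j]

end NDRData

end Classes

theorem exists_monoidHom_lift {A M P : Type*} [MulOneClass A] [MulOneClass M] [MulOneClass P]
    {f : M →* P} (hf : Function.Injective f) (g : A →* P) (h : ∀ a, ∃ b, f b = g a) :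
    ∃ g' : A →* M, ∀ a, f (g' a) = g a := by
  choose g' hg' using h
  exact ⟨⟨⟨g', hf (by rw [hg', map_one, map_one])⟩,
    fun a b => hf (by rw [map_mul, hg', hg', hg', map_mul])⟩, hg'⟩

theorem NondegenerateBasepoint.nonempty_ndrData {X : Type u} [TopologicalSpace X] {x₀ : X}
    (hx₀ : NondegenerateBasepoint x₀) : Nonempty (NDRData x₀) := by
  obtain ⟨v, h, v_eq_zero, h_zero, h_base, h_one⟩ := hx₀
  exact ⟨⟨v, h, (v_eq_zero x₀).2 rfl, h_zero, h_base, h_one⟩⟩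

theorem proposition2p7 {X : Type u} [TopologicalSpace X] [CompactlyGeneratedSpace X]
    [PathConnectedSpace X] (x₀ : X) (hx₀ : NondegenerateBasepoint x₀)
    (hCW : HasCWHomotopyType X) (hcat : WeakLSCatLT x₀ 2) (n : ℕ) :
    (∀ a : HoClass (CGPow.base x₀ n) (1 : James x₀), IsUnit a) ∧
    (∀ b : HoClass (JamesFil.base x₀ n) (1 : James x₀), IsUnit b) ∧
    ∃ (eK : CohenK n →* HoClass (CGPow.base x₀ n) (1 : James x₀)) (eH : cohenH n →* geomH x₀ n),
      (∀ i, eK (CohenK.x i) = xClass x₀ i) ∧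
      (∀ a, eK a ∈ geomK x₀ n) ∧
      ∀ a : cohenH n, qStar x₀ n (eH a : HoClass (JamesFil.base x₀ n) (1 : James x₀)) = eK a := by
  obtain ⟨L⟩ := James.nonempty_letterInversion hx₀ hCW
  obtain ⟨N⟩ := hx₀.nonempty_ndrData
  let D := L.toInversion
  let eK := (Units.coeHom _).comp (N.cohenRep D hcat n)
  have eK_mem_geomK : ∀ a, eK a ∈ geomK x₀ n := N.cohenRep_mem_geomK D hcat
  obtain ⟨eH, qStar_eH⟩ := exists_monoidHom_lift (N.qStar_injective D n)
    (eK.comp (cohenH n).subtype) fun a => N.exists_qStar_eq_cohenRep D hcat a.2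
  have eH_mem_geomH (a : cohenH n) : eH a ∈ geomH x₀ n := by
    change qStar x₀ n (eH a) ∈ geomK x₀ n
    exact (qStar_eH a).symm ▸ eK_mem_geomK a
  exact ⟨D.isUnit, D.isUnit, eK, eH.codRestrict (geomH x₀ n) eH_mem_geomH,
    fun i => congrArg Units.val (N.cohenRep_x D hcat i), eK_mem_geomK, qStar_eH⟩
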